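/- Let $D=\{z\in\mathbb C: |z|<1\}$, let $n$ be a positive integer or $n=\infty$, and let $(X/\Delta)$ be the orbifold $\left(D/(1-\tfrac1n)\{0\}\right)$, i.e. $X=D$ and $\Delta=(1-\tfrac1n)\{0\}$ with $\tfrac1\infty=0$. Put $X'=D$ if $n<\infty$ and $X'=D\setminus\{0\}$ if $n=\infty$. For $n<\infty$, an orbifold morphism (resp. a classical orbifold morphism) $D\to(X/\Delta)$ is a holomorphic map $h:D\to D$ such that, if $n\ge 2$, $h\not\equiv 0$ and at every zero of $h$ the vanishing order of $h$ is at least $n$ (resp. is a multiple of $n$); for $n=\infty$ both notions mean a holomorphic map $h:D\to D\setminus\{0\}$. Let $d_P$ be the Poincaré distance on $D$, i.e. the distance induced by the metric $\frac{4\,dz\,d\bar z}{(1-|z|^2)^2}$. The orbifold Kobayashi pseudo-distance $d_{(X/\Delta)}$ (resp. the classical orbifold Kobayashi pseudo-distance $d^*_{(X/\Delta)}$) is the largest pseudo-distance $\delta$ on $X'$ such that $\delta(g(z),g(w))\le d_P(z,w)$ for all $z,w\in D$ and every orbifold morphism (resp. classical orbifold morphism) $g:D\to(X/\Delta)$. Then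 both of these largest pseudo-distances exist, and $$d_{(X/\Delta)}=d^*_{(X/\Delta)}=d,$$ where $d$ is the distance induced on $X'$ (infimum of the lengths of $C^1$ paths in $X'$ joining two points) by the metric $$\omega=\frac{4\,dz\,d\bar z}{n^2|z|^{2-\frac2n}\left(1-|z|^{\frac2n}\right)^2}\quad\text{if } n<\infty,\qquad \omega=\frac{4\,dz\,d\bar z}{|z|^2\left(\log|z|^2\right)^2}\quad\text{if } n=\infty.$$ -/

import Mathlib

open scoped ENNReal

noncomputable section

namespace OrbifoldKobayashi

/-- The open unit disk `D` in `ℂ`. -/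
def unitDisk : Set ℂ := Metric.ball 0 1

/-- A one-dimensional geometric orbifold `(X/Δ)` on an open set `X ⊆ ℂ`, where
`Δ = ∑ p, (1 - 1 / mult p) • {p}`. The points with `mult p = 1` have coefficient `0`. -/
structure PlaneOrbifold where
  carrier : Set ℂ
  isOpen_carrier : IsOpen carrier
  mult : ℂ → ℕ∞
  mult_pos : ∀ p, 0 < mult p
  /-- Only points of `X` occur in `Δ`. -/
  mem_carrier_of_mult_ne_one : ∀ p, mult p ≠ 1 → p ∈ carrier
  /-- The sum defining `Δ` is locally finite on `X`. -/
  locally_finite : ∀ p ∈ carrier, ∃ U ∈ nhds p, {q ∈ U | mult q ≠ 1}.Finite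

namespace PlaneOrbifold

variable (X : PlaneOrbifold)

/-- The support of `Δ`. -/
def supp : Set ℂ := {p | X.mult p ≠ 1}

/-- `Δ₁`, the set of the points with coefficient `1` in `Δ`, i.e. of infinite multiplicity. -/
def deltaOne : Set ℂ := {p | X.mult p = ⊤}

/-- The set `X \ Δ₁`, as a type. -/
abbrev Points : Type := {p : ℂ // p ∈ X.carrier \ X.deltaOne}

/-- `h : D → X` is a (non-classical) orbifold morphism. The multiplicity at `x` of the divisor
`h^*{p}` is the order of vanishing of `h - p` at `x`. -/
structure IsOrbifoldMorphism (h : ℂ → ℂ) : Prop where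
  differentiableOn : DifferentiableOn ℂ h unitDisk
  mapsTo : Set.MapsTo h unitDisk X.carrier
  not_subset : ¬ h '' unitDisk ⊆ X.supp
  le_order : ∀ p ∈ X.supp, X.mult p ≠ ⊤ → ∀ x ∈ unitDisk, h x = p →
    X.mult p ≤ analyticOrderAt (fun t => h t - p) x
  avoids : ∀ p, X.mult p = ⊤ → ∀ x ∈ unitDisk, h x ≠ p

/-- `h : D → X` is a classical orbifold morphism: multiplicities are multiples of `mult p`. -/
structure IsClassicalOrbifoldMorphism (h : ℂ → ℂ) : Prop where
  differentiableOn : DifferentiableOn ℂ h unitDisk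
  mapsTo : Set.MapsTo h unitDisk X.carrier
  not_subset : ¬ h '' unitDisk ⊆ X.supp
  dvd_order : ∀ p ∈ X.supp, X.mult p ≠ ⊤ → ∀ x ∈ unitDisk, h x = p →
    X.mult p ∣ analyticOrderAt (fun t => h t - p) x
  avoids : ∀ p, X.mult p = ⊤ → ∀ x ∈ unitDisk, h x ≠ p

variable {X}

theorem IsOrbifoldMorphism.mem {h : ℂ → ℂ} (H : X.IsOrbifoldMorphism h) {z : ℂ}
    (hz : z ∈ unitDisk) : h z ∈ X.carrier \ X.deltaOne :=
  ⟨H.mapsTo hz, fun hp => H.avoids _ hp z hz rfl⟩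

theorem IsClassicalOrbifoldMorphism.mem {h : ℂ → ℂ} (H : X.IsClassicalOrbifoldMorphism h) {z : ℂ}
    (hz : z ∈ unitDisk) : h z ∈ X.carrier \ X.deltaOne :=
  ⟨H.mapsTo hz, fun hp => H.avoids _ hp z hz rfl⟩

end PlaneOrbifold

/-- A pseudo-distance on a set. -/
structure IsPseudoDist {α : Type} (d : α → α → ℝ) : Prop where
  nonneg : ∀ x y, 0 ≤ d x y
  self : ∀ x, d x x = 0
  symm : ∀ x y, d x y = d y x
  triangle : ∀ x y z, d x z ≤ d x y + d y z

/-- The length of the path `γ : [0, 1] → ℂ` for the (possibly singular) metric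
`ω = c(z) dz dz̄`, that is, the integral of `√(c (γ t)) * |γ' t|` over `[0, 1]`. -/
def pathLength (c : ℂ → ℝ≥0∞) (γ : ℝ → ℂ) : ℝ≥0∞ :=
  ∫⁻ t in Set.Icc (0 : ℝ) 1, c (γ t) ^ (1 / 2 : ℝ) * ‖derivWithin γ (Set.Icc 0 1) t‖ₑ

/-- The distance on `Y ⊆ ℂ` induced by `ω = c(z) dz dz̄`: the infimum of the lengths of the `C¹`
paths in `Y` from `x` to `y`. The velocity may vanish, so piecewise `C¹` paths give the same
infimum. -/
def inducedEDist (Y : Set ℂ) (c : ℂ → ℝ≥0∞) (x y : ℂ) : ℝ≥0∞ :=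
  ⨅ (γ : ℝ → ℂ) (_ : ContDiffOn ℝ 1 γ (Set.Icc 0 1)) (_ : Set.MapsTo γ (Set.Icc 0 1) Y)
    (_ : γ 0 = x) (_ : γ 1 = y), pathLength c γ

/-- The coefficient of the Poincaré metric `4 dz dz̄ / (1 - |z|²)²`. -/
def poincareCoeff (z : ℂ) : ℝ≥0∞ :=
  4 / ENNReal.ofReal ((1 - ‖z‖ ^ 2) ^ 2)

/-- The Poincaré distance `d_P` on the unit disk, induced by the Poincaré metric. -/
def poincareEDist : ℂ → ℂ → ℝ≥0∞ := inducedEDist unitDisk poincareCoeff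

namespace PlaneOrbifold

variable (X : PlaneOrbifold)

/-- The pseudo-distances `d` on `X \ Δ₁` such that `g^* d ≤ d_P` for every orbifold morphism
`g : D → (X/Δ)`. -/
def decreasingPseudoDists : Set (X.Points → X.Points → ℝ) :=
  {d | IsPseudoDist d ∧ ∀ (g : ℂ → ℂ) (hg : X.IsOrbifoldMorphism g) (z w : ℂ)
    (hz : z ∈ unitDisk) (hw : w ∈ unitDisk),
    ENNReal.ofReal (d ⟨g z, hg.mem hz⟩ ⟨g w, hg.mem hw⟩) ≤ poincareEDist z w}

/-- The pseudo-distances `d` on `X \ Δ₁` such that `g^* d ≤ d_P` for every classical orbifold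
morphism `g : D → (X/Δ)`. -/
def classicalDecreasingPseudoDists : Set (X.Points → X.Points → ℝ) :=
  {d | IsPseudoDist d ∧ ∀ (g : ℂ → ℂ) (hg : X.IsClassicalOrbifoldMorphism g) (z w : ℂ)
    (hz : z ∈ unitDisk) (hw : w ∈ unitDisk),
    ENNReal.ofReal (d ⟨g z, hg.mem hz⟩ ⟨g w, hg.mem hw⟩) ≤ poincareEDist z w}

/-- The orbifold Kobayashi pseudo-distance `d_(X/Δ)`: the pointwise supremum of
`decreasingPseudoDists`, which is its largest element whenever there is one. -/
def kobayashiDist (x y : X.Points) : ℝ := sSup {r | ∃ d ∈ X.decreasingPseudoDists, d x y = r}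

/-- The classical orbifold Kobayashi pseudo-distance `d^*_(X/Δ)`. -/
def classicalKobayashiDist (x y : X.Points) : ℝ :=
  sSup {r | ∃ d ∈ X.classicalDecreasingPseudoDists, d x y = r}

end PlaneOrbifold

/-- The orbifold `(D / (1 - 1/n){0})`, with `0 < n ∈ ℕ ∪ {∞}`. -/
def orbifoldDisk (n : ℕ∞) (hn : 0 < n) : PlaneOrbifold where
  carrier := unitDisk
  isOpen_carrier := Metric.isOpen_ball
  mult p := if p = 0 then n else 1
  mult_pos p := by
    split_ifs
    · exact hn
    · exact one_pos
  mem_carrier_of_mult_ne_one p hp := by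
    by_cases h : p = 0
    · subst h; simp [unitDisk]
    · simp [h] at hp
  locally_finite p _ := by
    refine ⟨Set.univ, Filter.univ_mem, (Set.finite_singleton (0 : ℂ)).subset ?_⟩
    rintro q ⟨-, hq⟩
    by_contra h
    have h' : q ≠ 0 := h
    simp [h'] at hq

/-- The coefficient of the metric `ω` on the orbifold disk:
`4 dz dz̄ / (n² |z|^(2 - 2/n) (1 - |z|^(2/n))²)` for finite `n`, and
`4 dz dz̄ / (|z|² (log |z|²)²)` for `n = ∞`. For `2 ≤ n < ∞` its value at `0` is `∞`. -/
def orbifoldCoeff : ℕ∞ → ℂ → ℝ≥0∞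
  | (n : ℕ), z => 4 / ENNReal.ofReal
      ((n : ℝ) ^ 2 * ‖z‖ ^ (2 - 2 / (n : ℝ)) * (1 - ‖z‖ ^ (2 / (n : ℝ))) ^ 2)
  | ⊤, z => 4 / ENNReal.ofReal (‖z‖ ^ 2 * Real.log (‖z‖ ^ 2) ^ 2)

end OrbifoldKobayashi

end

noncomputable section

namespace OrbifoldKobayashi

open Metric Set Filter Topology ComplexConjugate MeasureTheory

/-! Away from the origin `ω = 4 dz dz̄ / W²`, where `W(z) = 2n|z| sinh(-log|z| / n)` for finite `n`
and `W(z) = -2|z| log|z|`, its limit, for `n = ∞`. Let `d` be the distance induced by `ω`.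

Membership of `d`: every orbifold morphism `g` satisfies the Schwarz inequality `|g'(w)| (1 - |w|²)
≤ W(g(w))` wherever `g(w) ≠ 0`. Integrated along paths, this says that `g` contracts `d_P` to `d`.
When zeros only have order at least `N`, `g` need not have an `N`-th root, so the inequality is not
a pullback of the usual Schwarz lemma. At `w = 0` it is proved by induction on the number of zeros.
A zero-free `g` has a logarithm in a half-plane, which gives the bound with `n = ∞`, and `t ≤ sinh
t` makes this the stronger bound. A zero of order `k ≥ N` is divided out by a Blaschke power, and
the product rule reduces the step to convexity properties of `sinh`. Dilations reduce to finitely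
many zeros, and disk automorphisms move `0` to any point.

Maximality of `d`: `z ↦ z^n`, or `exp((z+1)/(z-1))` when `n = ∞`, is a classical orbifold morphism
for which the Schwarz inequality is an equality. A path avoiding `0` lifts through it with the same
length, so a decreasing pseudo-distance is at most the length of that path. Paths through `0`
(finite `n`) are cut at their first and last zeros, and continuity of the pseudo-distance at `0`
handles the ends.

Membership thus holds against all orbifold morphisms and maximality needs only a classical one, so
the same `d` is greatest in both families. -/

/-! ### Inequalities for `sinh`, and the zero-free Schwarz lemma at the origin. -/

theorem sinh_add_le {x y : ℝ} (hx : 0 ≤ x) (hy : 0 ≤ y) :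
    Real.sinh x + Real.sinh y ≤ Real.sinh (x + y) := by
  rw [Real.sinh_add]
  have h1 := Real.sinh_nonneg_iff.2 hx
  have h2 := Real.sinh_nonneg_iff.2 hy
  nlinarith [Real.one_le_cosh x, Real.one_le_cosh y]

/-- The difference of the two sides vanishes at `t = 0` and has derivative `s (cosh (s t) - cosh t)
≥ 0`. -/
theorem mul_sinh_le_sinh_mul {s t : ℝ} (hs : 1 ≤ s) (ht : 0 ≤ t) :
    s * Real.sinh t ≤ Real.sinh (s * t) := by
  have hd : ∀ x : ℝ, HasDerivAt (fun x => Real.sinh (s * x) - s * Real.sinh x)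
      (Real.cosh (s * x) * s - s * Real.cosh x) x := fun x => by
    have h1 : HasDerivAt (fun x : ℝ => s * x) s x := by
      simpa using (hasDerivAt_id x).const_mul s
    exact ((Real.hasDerivAt_sinh (s * x)).comp x h1).sub ((Real.hasDerivAt_sinh x).const_mul s)
  have hm : MonotoneOn (fun x => Real.sinh (s * x) - s * Real.sinh x) (Ici 0) := by
    refine monotoneOn_of_deriv_nonneg (convex_Ici 0)
      (fun x _ => (hd x).continuousAt.continuousWithinAt)
      (fun x _ => (hd x).differentiableAt.differentiableWithinAt) fun x hx => ?_
    rw [interior_Ici] at hx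
    have hx0 : 0 ≤ x := le_of_lt hx
    rw [(hd x).deriv]
    have : Real.cosh x ≤ Real.cosh (s * x) := by
      rw [Real.cosh_le_cosh, abs_of_nonneg hx0, abs_of_nonneg (by positivity)]
      nlinarith
    nlinarith
  have := hm self_mem_Ici ht ht
  simp at this
  linarith

/-- Schwarz lemma for a function without zeros. -/
theorem norm_deriv_le_of_forall_ne_zero {g : ℂ → ℂ} (hg : DifferentiableOn ℂ g (ball 0 1))
    (hb : ∀ z ∈ ball (0 : ℂ) 1, ‖g z‖ ≤ 1) (h0 : ∀ z ∈ ball (0 : ℂ) 1, g z ≠ 0) :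
    ‖deriv g 0‖ ≤ ‖g 0‖ * (2 * -Real.log ‖g 0‖) := by
  have m0 : (0 : ℂ) ∈ ball (0 : ℂ) 1 := by simp
  have hgd : DifferentiableOn ℂ (deriv g) (ball 0 1) := hg.deriv isOpen_ball
  -- A primitive of `g' / g` with the right value at `0` is a logarithm of `g`, because `g * exp
  -- (-f)` has derivative zero.
  obtain ⟨f, hf0, hf⟩ := ((hgd.div hg h0).isExactOn_ball).with_val_at 0 (Complex.log (g 0))
  have hfd : DifferentiableOn ℂ f (ball 0 1) := fun z hz =>
    (hf z hz).differentiableAt.differentiableWithinAt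
  have hexp : ∀ z ∈ ball (0 : ℂ) 1, g z = Complex.exp (f z) := by
    have hk : ∀ z ∈ ball (0 : ℂ) 1, HasDerivAt (fun z => g z * Complex.exp (-f z)) 0 z := by
      intro z hz
      have h1 := (hg.differentiableAt (isOpen_ball.mem_nhds hz)).hasDerivAt
      have h2 := h1.mul (hf z hz).neg.cexp
      convert! h2 using 1
      have := h0 z hz
      simp only [Pi.div_apply]
      field_simp
      ring
    intro z hz
    have := (convex_ball (0 : ℂ) 1).is_const_of_fderivWithin_eq_zero (𝕜 := ℂ)
      (f := fun z => g z * Complex.exp (-f z))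
      (fun z hz => (hk z hz).differentiableAt.differentiableWithinAt)
      (fun z hz => by
        rw [fderivWithin_of_isOpen isOpen_ball hz]
        ext; simp [(hk z hz).deriv]) hz m0
    simp only [hf0, Complex.exp_neg, Complex.exp_log (h0 0 m0)] at this
    rw [mul_inv_cancel₀ (h0 0 m0)] at this
    have he := Complex.exp_ne_zero (f z)
    field_simp at this
    exact this
  have hre : ∀ z ∈ ball (0 : ℂ) 1, (f z).re ≤ 0 := fun z hz => by
    have := hb z hz
    rw [hexp z hz, Complex.norm_exp] at this
    exact Real.exp_le_one_iff.1 this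
  have hlog : Real.log ‖g 0‖ = (f 0).re := by rw [hexp 0 m0, Complex.norm_exp, Real.log_exp]
  have key : ‖deriv f 0‖ ≤ 2 * -(f 0).re := by
    refine le_of_forall_pos_le_add fun ε hε => ?_
    -- The map `ζ ↦ (ζ - f 0) / (ζ + conj (f 0))` sends the left half-plane to the disk. Since only
    -- `Re f ≤ 0` is known, the shift by `ε` keeps the denominator nonzero.
    set c : ℂ := conj (f 0) - (ε : ℂ) with hc
    have hden : ∀ z ∈ ball (0 : ℂ) 1, f z + c ≠ 0 := fun z hz h => by
      have := congrArg Complex.re h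
      simp [hc] at this
      linarith [hre z hz, hre 0 m0]
    have hq : DifferentiableOn ℂ (fun z => (f z - f 0) / (f z + c)) (ball 0 1) :=
      (hfd.sub_const _).div (hfd.add_const _) hden
    have hmap : MapsTo (fun z => (f z - f 0) / (f z + c)) (ball 0 1)
        (closedBall ((f 0 - f 0) / (f 0 + c)) 1) := fun z hz => by
      simp only [sub_self, zero_div, mem_closedBall, dist_zero_right, norm_div]
      refine div_le_one_of_le₀ ?_ (norm_nonneg _)
      rw [← pow_le_pow_iff_left₀ (norm_nonneg _) (norm_nonneg _) two_ne_zero, Complex.sq_norm,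
        Complex.sq_norm]
      simp only [Complex.normSq_apply, hc, Complex.sub_re, Complex.sub_im, Complex.add_re,
        Complex.add_im, Complex.conj_re, Complex.conj_im, Complex.ofReal_re, Complex.ofReal_im]
      nlinarith [hre z hz, hre 0 m0, mul_nonneg_of_nonpos_of_nonpos (hre z hz) (hre 0 m0)]
    have hs := Complex.norm_deriv_le_one_of_mapsTo_ball hq hmap one_pos
    have hfa := (hfd.differentiableAt (isOpen_ball.mem_nhds m0)).hasDerivAt
    have hder : HasDerivAt (fun z => (f z - f 0) / (f z + c)) (deriv f 0 / (f 0 + c)) 0 := by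
      have := (hfa.sub_const (f 0)).div (hfa.add_const c) (hden 0 m0)
      convert! this using 1
      have := hden 0 m0
      field_simp
      ring
    rw [hder.deriv, norm_div, div_le_one (norm_pos_iff.2 (hden 0 m0))] at hs
    refine hs.trans ?_
    have : f 0 + c = ((2 * (f 0).re - ε : ℝ) : ℂ) := by
      apply Complex.ext <;> simp [hc]; ring
    rw [this, Complex.norm_real, Real.norm_eq_abs, abs_of_nonpos (by linarith [hre 0 m0])]
    linarith
  have hd : deriv f 0 = deriv g 0 / g 0 := (hf 0 m0).deriv
  rw [hd, norm_div, div_le_iff₀ (norm_pos_iff.2 (h0 0 m0))] at key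
  rw [hlog]
  linarith

/-! ### Blaschke factors, and the Schwarz lemma with zeros of order at least `N`. -/

theorem one_sub_conj_mul_ne_zero {a z : ℂ} (ha : ‖a‖ < 1) (hz : ‖z‖ ≤ 1) :
    1 - conj a * z ≠ 0 := by
  intro h
  have h1 : ‖conj a * z‖ = 1 := by rw [← sub_eq_zero.1 h]; simp
  rw [norm_mul, RCLike.norm_conj] at h1
  nlinarith [norm_nonneg a, norm_nonneg z]

/-- The Blaschke factor with its zero at `a`. -/
def blaschke (a z : ℂ) : ℂ := (z - a) / (1 - conj a * z)

theorem hasDerivAt_blaschke {a z : ℂ} (h : 1 - conj a * z ≠ 0) :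
    HasDerivAt (blaschke a) ((1 - conj a * a) / (1 - conj a * z) ^ 2) z := by
  have h1 : HasDerivAt (fun z : ℂ => z - a) 1 z := (hasDerivAt_id z).sub_const a
  have h2 : HasDerivAt (fun z : ℂ => 1 - conj a * z) (-conj a) z := by
    simpa using ((hasDerivAt_id z).const_mul (conj a)).const_sub 1
  convert! h1.div h2 h using 1
  ring

theorem blaschke_ne_zero {a z : ℂ} (ha : ‖a‖ < 1) (hz : ‖z‖ ≤ 1) (hza : z ≠ a) :
    blaschke a z ≠ 0 :=
  div_ne_zero (sub_ne_zero.2 hza) (one_sub_conj_mul_ne_zero ha hz)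

theorem normSq_one_sub_conj_mul_sub (a z : ℂ) :
    ‖1 - conj a * z‖ ^ 2 - ‖z - a‖ ^ 2 = (1 - ‖a‖ ^ 2) * (1 - ‖z‖ ^ 2) := by
  simp only [Complex.sq_norm, Complex.normSq_apply, Complex.sub_re, Complex.sub_im,
    Complex.one_re, Complex.one_im, Complex.mul_re, Complex.mul_im, Complex.conj_re,
    Complex.conj_im]
  ring

theorem norm_blaschke_eq_one {a z : ℂ} (ha : ‖a‖ < 1) (hz : ‖z‖ = 1) : ‖blaschke a z‖ = 1 := by
  have h := normSq_one_sub_conj_mul_sub a z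
  rw [hz] at h
  have h' : ‖z - a‖ = ‖1 - conj a * z‖ := by
    rw [← pow_left_inj₀ (norm_nonneg _) (norm_nonneg _) two_ne_zero]; linarith
  rw [blaschke, norm_div, h', div_self (norm_ne_zero_iff.2 (one_sub_conj_mul_ne_zero ha hz.le))]

theorem norm_blaschke_lt_one {a z : ℂ} (ha : ‖a‖ < 1) (hz : ‖z‖ < 1) : ‖blaschke a z‖ < 1 := by
  have h := normSq_one_sub_conj_mul_sub a z
  have hp : 0 < ‖1 - conj a * z‖ := norm_pos_iff.2 (one_sub_conj_mul_ne_zero ha hz.le)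
  rw [blaschke, norm_div, div_lt_one hp]
  refine lt_of_pow_lt_pow_left₀ 2 hp.le ?_
  nlinarith [norm_nonneg a, norm_nonneg z, mul_pos (show 0 < 1 - ‖a‖ ^ 2 by
    nlinarith [norm_nonneg a]) (show 0 < 1 - ‖z‖ ^ 2 by nlinarith [norm_nonneg z])]

theorem differentiableAt_blaschke {a z : ℂ} (ha : ‖a‖ < 1) (hz : ‖z‖ ≤ 1) :
    DifferentiableAt ℂ (blaschke a) z :=
  (hasDerivAt_blaschke (one_sub_conj_mul_ne_zero ha hz)).differentiableAt

/-- A zero of a function on the closed disk can be divided out by a power of a Blaschke factor. -/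
theorem exists_eq_blaschke_pow_mul {g : ℂ → ℂ} (hg : DiffContOnCl ℂ g (ball 0 1))
    (hb : ∀ z ∈ closedBall (0 : ℂ) 1, ‖g z‖ ≤ 1) {a : ℂ} (ha : ‖a‖ < 1) {k : ℕ}
    (hk : analyticOrderAt g a = k) :
    ∃ g₁ : ℂ → ℂ, DiffContOnCl ℂ g₁ (ball 0 1) ∧ (∀ z ∈ closedBall (0 : ℂ) 1, ‖g₁ z‖ ≤ 1) ∧
      g₁ a ≠ 0 ∧ ∀ z ∈ closedBall (0 : ℂ) 1, g z = blaschke a z ^ k * g₁ z := by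
  have han : AnalyticAt ℂ g a :=
    hg.differentiableOn.analyticAt (isOpen_ball.mem_nhds (by simpa using ha))
  obtain ⟨h, hh, hh0, hgh⟩ := (han.analyticOrderAt_eq_natCast).1 hk
  have hane : 1 - conj a * a ≠ 0 := one_sub_conj_mul_ne_zero ha ha.le
  classical
  -- The value at `a` removes the singularity: near `a` one has `g z = (z - a) ^ k * h z`, so the
  -- quotient is `h z * (1 - conj a * z) ^ k`.
  set g₁ : ℂ → ℂ := fun z => if z = a then h a * (1 - conj a * a) ^ k else g z / blaschke a z ^ k
    with hg₁
  have ha1 : g₁ a = h a * (1 - conj a * a) ^ k := by simp [hg₁]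
  have hmul : ∀ z ∈ closedBall (0 : ℂ) 1, g z = blaschke a z ^ k * g₁ z := by
    intro z hz
    by_cases hza : z = a
    · subst hza
      have := hgh.self_of_nhds
      rw [this, ha1]
      rcases Nat.eq_zero_or_pos k with rfl | hk0
      · simp
      · simp [blaschke, hk0.ne']
    · have : blaschke a z ≠ 0 := blaschke_ne_zero ha (by simpa using hz) hza
      simp only [hg₁, if_neg hza]
      field_simp
  have hloc : g₁ =ᶠ[𝓝 a] fun z => h z * (1 - conj a * z) ^ k := by
    have hne : ∀ᶠ z in 𝓝 a, 1 - conj a * z ≠ 0 :=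
      ContinuousAt.eventually_ne (by fun_prop) hane
    filter_upwards [hgh, hne] with z hz hz'
    by_cases hza : z = a
    · subst hza; exact ha1
    · have : z - a ≠ 0 := sub_ne_zero.2 hza
      simp only [hg₁, if_neg hza, hz, blaschke, smul_eq_mul, div_pow]
      field_simp
  have hother : ∀ z, z ≠ a → g₁ =ᶠ[𝓝 z] fun z => g z / blaschke a z ^ k := fun z hza => by
    filter_upwards [isOpen_ne.mem_nhds hza] with w hw
    simp only [hg₁, if_neg (show w ≠ a from hw)]
  have hd : DiffContOnCl ℂ g₁ (ball 0 1) := by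
    constructor
    · intro z hz
      apply DifferentiableAt.differentiableWithinAt
      by_cases hza : z = a
      · subst hza
        refine DifferentiableAt.congr_of_eventuallyEq ?_ hloc
        have := hh.differentiableAt
        fun_prop
      · have hz1 : ‖z‖ < 1 := by simpa using hz
        refine DifferentiableAt.congr_of_eventuallyEq ?_ (hother z hza)
        exact (hg.differentiableAt isOpen_ball hz).div
          ((differentiableAt_blaschke ha hz1.le).pow k)
          (pow_ne_zero _ (blaschke_ne_zero ha hz1.le hza))
    · rw [closure_ball _ one_ne_zero]
      intro z hz
      have hz1 : ‖z‖ ≤ 1 := by simpa using hz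
      by_cases hza : z = a
      · subst hza
        apply ContinuousAt.continuousWithinAt
        refine ContinuousAt.congr ?_ hloc.symm
        have := hh.continuousAt
        fun_prop
      · have hc := hg.continuousOn
        rw [closure_ball _ one_ne_zero] at hc
        refine ContinuousWithinAt.congr_of_eventuallyEq ?_
          ((hother z hza).filter_mono nhdsWithin_le_nhds) (hother z hza).self_of_nhds
        exact (hc z hz).div
          ((differentiableAt_blaschke ha hz1).continuousAt.continuousWithinAt.pow k)
          (pow_ne_zero _ (blaschke_ne_zero ha hz1 hza))
  refine ⟨g₁, hd, ?_, ?_, hmul⟩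
  · intro z hz
    -- Maximum principle: on the unit circle the Blaschke factor has modulus one, so `g₁` and `g`
    -- have the same modulus there.
    refine Complex.norm_le_of_forall_mem_frontier_norm_le (U := ball 0 1) isBounded_ball hd ?_
      (by rwa [closure_ball _ one_ne_zero])
    intro w hw
    rw [frontier_ball _ one_ne_zero, mem_sphere_zero_iff_norm] at hw
    have hwc : w ∈ closedBall (0 : ℂ) 1 := by simp [hw]
    have := hb w hwc
    rw [hmul w hwc, norm_mul, norm_pow, norm_blaschke_eq_one ha hw, one_pow, one_mul] at this
    exact this
  · rw [ha1]
    exact mul_ne_zero hh0 (pow_ne_zero _ hane)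

/-- Schwarz lemma at the origin for a function with finitely many zeros, all of them of order at
least `N`. -/
theorem norm_deriv_le_of_finite_zeros {N : ℕ} (hN : 0 < N) (m : ℕ) :
    ∀ {g : ℂ → ℂ}, DiffContOnCl ℂ g (ball 0 1) → (∀ z ∈ closedBall (0 : ℂ) 1, ‖g z‖ ≤ 1) →
      g 0 ≠ 0 → {z ∈ ball (0 : ℂ) 1 | g z = 0}.Finite →
      {z ∈ ball (0 : ℂ) 1 | g z = 0}.ncard = m →
      (∀ z ∈ ball (0 : ℂ) 1, g z = 0 → (N : ℕ∞) ≤ analyticOrderAt g z) →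
      ‖deriv g 0‖ ≤ ‖g 0‖ * (2 * N * Real.sinh (-Real.log ‖g 0‖ / N)) := by
  have hN' : (0 : ℝ) < N := by exact_mod_cast hN
  have m0 : (0 : ℂ) ∈ ball (0 : ℂ) 1 := by simp
  have c0 : (0 : ℂ) ∈ closedBall (0 : ℂ) 1 := by simp
  induction m with
  | zero =>
    intro g hg hb h0 hfin hcard hord
    rw [Set.ncard_eq_zero hfin] at hcard
    have hne : ∀ z ∈ ball (0 : ℂ) 1, g z ≠ 0 := fun z hz h =>
      (Set.eq_empty_iff_forall_notMem.1 hcard z) ⟨hz, h⟩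
    refine (norm_deriv_le_of_forall_ne_zero hg.differentiableOn
      (fun z hz => hb z (ball_subset_closedBall hz)) hne).trans ?_
    have hT : 0 ≤ -Real.log ‖g 0‖ / N :=
      div_nonneg (neg_nonneg.2 (Real.log_nonpos (norm_nonneg _) (hb 0 c0))) hN'.le
    have h1 := Real.self_le_sinh_iff.2 hT
    rw [div_le_iff₀ hN'] at h1
    gcongr ?_ * ?_
    linarith
  | succ m ih =>
    intro g hg hb h0 hfin hcard hord
    obtain ⟨a, ha, hga⟩ : {z ∈ ball (0 : ℂ) 1 | g z = 0}.Nonempty := by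
      rw [Set.nonempty_iff_ne_empty]
      intro h
      rw [h] at hcard
      simp at hcard
    have ha1 : ‖a‖ < 1 := by simpa using ha
    have han : AnalyticOnNhd ℂ g (ball 0 1) := hg.differentiableOn.analyticOnNhd isOpen_ball
    have htop : analyticOrderAt g a ≠ ⊤ := by
      intro h
      rw [analyticOrderAt_eq_top] at h
      exact h0 (han.eqOn_zero_of_preconnected_of_eventuallyEq_zero
        (convex_ball _ _).isPreconnected ha h m0)
    obtain ⟨k, hk⟩ := ENat.ne_top_iff_exists.1 htop
    have hNk : N ≤ k := by
      have := hord a ha hga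
      rw [← hk] at this
      exact_mod_cast this
    -- The whole order `k` at `a` is divided out, so `g₁` has one zero fewer and the same orders at
    -- the others.
    obtain ⟨g₁, hg₁, hb₁, hg₁a, hmul⟩ := exists_eq_blaschke_pow_mul hg hb ha1 hk.symm
    have hzero : {z ∈ ball (0 : ℂ) 1 | g₁ z = 0} = {z ∈ ball (0 : ℂ) 1 | g z = 0} \ {a} := by
      ext z
      simp only [mem_ofPred_eq, Set.mem_sdiff, mem_singleton_iff]
      constructor
      · rintro ⟨hz, h⟩
        refine ⟨⟨hz, by rw [hmul z (ball_subset_closedBall hz), h, mul_zero]⟩, ?_⟩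
        rintro rfl
        exact hg₁a h
      · rintro ⟨⟨hz, h⟩, hza⟩
        refine ⟨hz, ?_⟩
        rw [hmul z (ball_subset_closedBall hz)] at h
        exact (mul_eq_zero.1 h).resolve_left
          (pow_ne_zero _ (blaschke_ne_zero ha1 (by simpa using (mem_ball_zero_iff.1 hz).le) hza))
    have h01 : g₁ 0 ≠ 0 := fun h => h0 (by rw [hmul 0 c0, h, mul_zero])
    have ha0 : a ≠ 0 := by rintro rfl; exact h0 hga
    have IH := ih hg₁ hb₁ h01 (by rw [hzero]; exact hfin.subset sdiff_subset)
      (by rw [hzero, Set.ncard_sdiff_singleton_of_mem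
        (show a ∈ {z ∈ ball (0 : ℂ) 1 | g z = 0} from ⟨ha, hga⟩), hcard]; rfl) (by
        intro z hz hgz
        have hz' : z ∈ {z ∈ ball (0 : ℂ) 1 | g z = 0} \ {a} := by
          rw [← hzero]; exact ⟨hz, hgz⟩
        have hzn : ‖z‖ ≤ 1 := (mem_ball_zero_iff.1 hz).le
        have e : g =ᶠ[𝓝 z] (blaschke a ^ k) * g₁ := by
          filter_upwards [isOpen_ball.mem_nhds hz] with w hw
          exact hmul w (ball_subset_closedBall hw)
        have hba : AnalyticAt ℂ (blaschke a ^ k) z := by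
          have : DifferentiableOn ℂ (blaschke a) (ball 0 1) := fun w hw =>
            (differentiableAt_blaschke ha1 (mem_ball_zero_iff.1 hw).le).differentiableWithinAt
          exact (this.analyticAt (isOpen_ball.mem_nhds hz)).pow k
        have hb0 : analyticOrderAt (blaschke a ^ k) z = 0 := by
          rw [hba.analyticOrderAt_eq_zero]
          exact pow_ne_zero _ (blaschke_ne_zero ha1 hzn hz'.2)
        have := hord z hz hz'.1.2
        rwa [analyticOrderAt_congr e, analyticOrderAt_mul hba
          (hg₁.differentiableOn.analyticAt (isOpen_ball.mem_nhds hz)), hb0, zero_add] at this)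
    have hpa : 0 < ‖a‖ := norm_pos_iff.2 ha0
    have hp1 : 0 < ‖g₁ 0‖ := norm_pos_iff.2 h01
    have hbl0 : blaschke a 0 = -a := by simp [blaschke]
    have hg0 : ‖g 0‖ = ‖a‖ ^ k * ‖g₁ 0‖ := by
      rw [hmul 0 c0, norm_mul, norm_pow, hbl0, norm_neg]
    set τ := -Real.log ‖a‖ with hτ
    have hτ0 : 0 ≤ τ := neg_nonneg.2 (Real.log_nonpos hpa.le ha1.le)
    set T := -Real.log ‖g₁ 0‖ with hT
    have hT0 : 0 ≤ T := neg_nonneg.2 (Real.log_nonpos hp1.le (hb₁ 0 c0))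
    have hlog : -Real.log ‖g 0‖ = k * τ + T := by
      rw [hg0, Real.log_mul (by positivity) (by positivity), Real.log_pow]; ring
    have hsinh : 1 - ‖a‖ ^ 2 = ‖a‖ * (2 * Real.sinh τ) := by
      rw [Real.sinh_eq, hτ, neg_neg, Real.exp_neg, Real.exp_log hpa]; field_simp
    have hder : deriv g 0 = k * (-a) ^ (k - 1) * (1 - conj a * a) * g₁ 0
        + (-a) ^ k * deriv g₁ 0 := by
      have e : g =ᶠ[𝓝 0] fun z => blaschke a z ^ k * g₁ z := by
        filter_upwards [isOpen_ball.mem_nhds m0] with w hw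
        exact hmul w (ball_subset_closedBall hw)
      have h1 := hasDerivAt_blaschke (a := a) (z := 0) (by simp)
      have h2 := (hg₁.differentiableAt isOpen_ball m0).hasDerivAt
      rw [e.deriv_eq]
      have := ((h1.pow k).mul h2).deriv
      simp only [hbl0, mul_zero, sub_zero, one_pow, div_one] at this
      convert! this using 1
      simp [hbl0]
    have hk0 : 0 < k := lt_of_lt_of_le hN hNk
    -- The heart of the induction. Since `k / N ≥ 1`, the factor `k / N` can be moved inside `sinh
    -- τ`; superadditivity of `sinh` then merges the two terms.
    have hmain : k * Real.sinh τ + N * Real.sinh (T / N) ≤ N * Real.sinh ((k * τ + T) / N) := by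
      have h1 : (k / N : ℝ) * Real.sinh τ ≤ Real.sinh (k / N * τ) :=
        mul_sinh_le_sinh_mul ((one_le_div hN').2 (by exact_mod_cast hNk)) hτ0
      have h2 := sinh_add_le (x := (k / N : ℝ) * τ) (y := T / N) (by positivity) (by positivity)
      have h3 : (k * τ + T) / N = (k / N : ℝ) * τ + T / N := by ring
      rw [h3]
      calc k * Real.sinh τ + N * Real.sinh (T / N)
          = N * ((k / N : ℝ) * Real.sinh τ + Real.sinh (T / N)) := by field_simp
        _ ≤ _ := by gcongr; linarith
    have hnorm : ‖(1 : ℂ) - conj a * a‖ = 1 - ‖a‖ ^ 2 := by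
      have : (1 : ℂ) - conj a * a = ((1 - ‖a‖ ^ 2 : ℝ) : ℂ) := by
        rw [mul_comm, Complex.mul_conj, Complex.normSq_eq_norm_sq]; push_cast; ring
      rw [this, Complex.norm_real, Real.norm_eq_abs, abs_of_nonneg]
      nlinarith
    rw [hlog, hder, hg0]
    calc _ ≤ ‖k * (-a) ^ (k - 1) * (1 - conj a * a) * g₁ 0‖ + ‖(-a) ^ k * deriv g₁ 0‖ :=
          norm_add_le _ _
      _ = k * (‖a‖ ^ (k - 1) * ‖a‖) * (2 * Real.sinh τ) * ‖g₁ 0‖ + ‖a‖ ^ k * ‖deriv g₁ 0‖ := by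
          simp only [norm_mul, norm_pow, norm_neg, hnorm, hsinh, Complex.norm_natCast]; ring
      _ ≤ k * ‖a‖ ^ k * (2 * Real.sinh τ) * ‖g₁ 0‖ +
            ‖a‖ ^ k * (‖g₁ 0‖ * (2 * N * Real.sinh (T / N))) := by
          rw [pow_sub_one_mul hk0.ne']
          gcongr
      _ = ‖a‖ ^ k * ‖g₁ 0‖ * (2 * (k * Real.sinh τ + N * Real.sinh (T / N))) := by ring
      _ ≤ _ := by
          rw [mul_assoc 2 (N : ℝ)]
          gcongr

/-! ### The Schwarz lemmas at an arbitrary point of the disk. -/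

theorem hasDerivAt_blaschke_neg_zero (w : ℂ) :
    HasDerivAt (blaschke (-w)) ((1 - ‖w‖ ^ 2 : ℝ) : ℂ) 0 := by
  have h := hasDerivAt_blaschke (a := -w) (z := 0) (by simp)
  convert! h using 1
  simp only [map_neg, neg_mul_neg, mul_zero, sub_zero, one_pow, div_one]
  rw [mul_comm, Complex.mul_conj, Complex.normSq_eq_norm_sq]
  push_cast; ring

theorem blaschke_neg_zero (w : ℂ) : blaschke (-w) 0 = w := by simp [blaschke]

theorem differentiableOn_blaschke {a : ℂ} (ha : ‖a‖ < 1) :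
    DifferentiableOn ℂ (blaschke a) (ball 0 1) := fun _ hz =>
  (differentiableAt_blaschke ha (mem_ball_zero_iff.1 hz).le).differentiableWithinAt

theorem mapsTo_blaschke {a : ℂ} (ha : ‖a‖ < 1) :
    MapsTo (blaschke a) (ball 0 1) (ball 0 1) := fun z hz => by
  rw [mem_ball_zero_iff] at hz ⊢
  exact norm_blaschke_lt_one ha hz

theorem one_sub_norm_sq_pos {w : ℂ} (hw : ‖w‖ < 1) : 0 < 1 - ‖w‖ ^ 2 := by
  nlinarith [norm_nonneg w]

/-- Schwarz lemma for holomorphic maps from the disk to the punctured disk. -/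
theorem schwarz_of_forall_ne_zero {g : ℂ → ℂ} (hg : DifferentiableOn ℂ g (ball 0 1))
    (hb : ∀ z ∈ ball (0 : ℂ) 1, ‖g z‖ ≤ 1) (h0 : ∀ z ∈ ball (0 : ℂ) 1, g z ≠ 0)
    {w : ℂ} (hw : ‖w‖ < 1) :
    ‖deriv g w‖ * (1 - ‖w‖ ^ 2) ≤ ‖g w‖ * (2 * -Real.log ‖g w‖) := by
  have hw' : ‖-w‖ < 1 := by simpa using hw
  have hm := mapsTo_blaschke hw'
  have h := norm_deriv_le_of_forall_ne_zero (g := g ∘ blaschke (-w))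
    (hg.comp (differentiableOn_blaschke hw') hm) (fun z hz => hb _ (hm hz))
    (fun z hz => h0 _ (hm hz))
  have hd : HasDerivAt g (deriv g w) (blaschke (-w) 0) := by
    rw [blaschke_neg_zero]
    exact (hg.differentiableAt (isOpen_ball.mem_nhds (by simpa using hw))).hasDerivAt
  rw [(hd.comp 0 (hasDerivAt_blaschke_neg_zero w)).deriv] at h
  simp only [Function.comp_apply, blaschke_neg_zero, norm_mul, Complex.norm_real,
    Real.norm_eq_abs] at h
  rwa [abs_of_pos (one_sub_norm_sq_pos hw)] at h

/-- Schwarz–Pick lemma at a zero. -/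
theorem schwarz_of_eq_zero {g : ℂ → ℂ} (hg : DifferentiableOn ℂ g (ball 0 1))
    (hb : ∀ z ∈ ball (0 : ℂ) 1, ‖g z‖ ≤ 1) {w : ℂ} (hw : ‖w‖ < 1) (h0 : g w = 0) :
    ‖deriv g w‖ * (1 - ‖w‖ ^ 2) ≤ 1 := by
  have hw' : ‖-w‖ < 1 := by simpa using hw
  have hm := mapsTo_blaschke hw'
  have h := Complex.norm_deriv_le_one_of_mapsTo_ball (f := g ∘ blaschke (-w)) (c := 0) (R := 1)
    (hg.comp (differentiableOn_blaschke hw') hm) (fun z hz => by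
      simpa [blaschke_neg_zero, h0] using hb _ (hm hz)) one_pos
  have hd : HasDerivAt g (deriv g w) (blaschke (-w) 0) := by
    rw [blaschke_neg_zero]
    exact (hg.differentiableAt (isOpen_ball.mem_nhds (by simpa using hw))).hasDerivAt
  rw [(hd.comp 0 (hasDerivAt_blaschke_neg_zero w)).deriv] at h
  simp only [norm_mul, Complex.norm_real, Real.norm_eq_abs] at h
  rwa [abs_of_pos (one_sub_norm_sq_pos hw)] at h

/-- Schwarz lemma for holomorphic self-maps of the disk all of whose zeros have order at least
`N`. -/
theorem schwarz_of_le_order {N : ℕ} (hN : 0 < N) {g : ℂ → ℂ}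
    (hg : DifferentiableOn ℂ g (ball 0 1)) (hb : ∀ z ∈ ball (0 : ℂ) 1, ‖g z‖ ≤ 1)
    (hord : ∀ z ∈ ball (0 : ℂ) 1, g z = 0 → (N : ℕ∞) ≤ analyticOrderAt g z)
    {w : ℂ} (hw : ‖w‖ < 1) (h0 : g w ≠ 0) :
    ‖deriv g w‖ * (1 - ‖w‖ ^ 2) ≤ ‖g w‖ * (2 * N * Real.sinh (-Real.log ‖g w‖ / N)) := by
  have hw' : ‖-w‖ < 1 := by simpa using hw
  set B := ‖g w‖ * (2 * N * Real.sinh (-Real.log ‖g w‖ / N))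
  set A := ‖deriv g w‖ * (1 - ‖w‖ ^ 2)
  -- For `r < 1`, the composite of `g` with `z ↦ blaschke (-w) (r z)` is holomorphic on the disk of
  -- radius `1 / r`. It is therefore continuous on the closed unit disk with finitely many zeros
  -- there; the loss of a factor `r` disappears as `r → 1`.
  have key : ∀ r ∈ Ioo (0 : ℝ) 1, r * A ≤ B := by
    intro r hr
    have hmul : MapsTo (fun z : ℂ => (r : ℂ) * z) (ball 0 r⁻¹) (ball 0 1) := fun z hz => by
      rw [mem_ball_zero_iff] at hz ⊢
      rw [norm_mul, Complex.norm_real, Real.norm_eq_abs, abs_of_pos hr.1]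
      calc r * ‖z‖ < r * r⁻¹ := by gcongr; exact hr.1
        _ = 1 := mul_inv_cancel₀ hr.1.ne'
    have hsub : closedBall (0 : ℂ) 1 ⊆ ball 0 r⁻¹ :=
      closedBall_subset_ball ((one_lt_inv₀ hr.1).2 hr.2)
    set ψ : ℂ → ℂ := fun z => blaschke (-w) ((r : ℂ) * z) with hψ
    have hψm : MapsTo ψ (ball 0 r⁻¹) (ball 0 1) := fun z hz => mapsTo_blaschke hw' (hmul hz)
    have hψd : ∀ z ∈ ball (0 : ℂ) r⁻¹, HasDerivAt ψ
        ((1 - conj (-w) * (-w)) / (1 - conj (-w) * (r * z)) ^ 2 * r) z := fun z hz => by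
      have h1 : HasDerivAt (fun z : ℂ => (r : ℂ) * z) r z := by
        simpa using (hasDerivAt_id z).const_mul (r : ℂ)
      exact (hasDerivAt_blaschke (one_sub_conj_mul_ne_zero hw'
        (mem_ball_zero_iff.1 (hmul hz)).le)).comp z h1
    have hψdiff : DifferentiableOn ℂ ψ (ball 0 r⁻¹) := fun z hz =>
      (hψd z hz).differentiableAt.differentiableWithinAt
    have hGd : DifferentiableOn ℂ (g ∘ ψ) (ball 0 r⁻¹) := hg.comp hψdiff hψm
    have hψ0 : ψ 0 = w := by simp [hψ, blaschke_neg_zero]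
    have hGan : AnalyticOnNhd ℂ (g ∘ ψ) (ball 0 r⁻¹) := hGd.analyticOnNhd isOpen_ball
    have hfin : {z ∈ ball (0 : ℂ) 1 | (g ∘ ψ) z = 0}.Finite := by
      rcases hGan.eqOn_zero_or_eventually_ne_zero_of_preconnected
        (convex_ball _ _).isPreconnected with h | h
      · exact absurd (h (hsub (by simp : (0 : ℂ) ∈ closedBall (0 : ℂ) 1))) (by simpa [hψ0] using h0)
      · have h2 := Filter.codiscreteWithin_mono hsub h
        refine ((isCompact_closedBall (0 : ℂ) 1).finite_sdiff_of_mem_codiscreteWithin h2).subset ?_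
        rintro z ⟨hz, hz0⟩
        exact ⟨ball_subset_closedBall hz, fun hne => hne hz0⟩
    have h := norm_deriv_le_of_finite_zeros hN _ (g := g ∘ ψ)
      ((hGd.mono hsub).diffContOnCl_ball (U := closedBall 0 1) subset_rfl)
      (fun z hz => hb _ (hψm (hsub hz))) (by simpa [hψ0] using h0) hfin rfl (by
        intro z hz hz0
        have hzr := hsub (ball_subset_closedBall hz)
        -- Orders of zeros survive the change of variable because `ψ` has nonvanishing derivative.
        rw [analyticOrderAt_comp_of_deriv_ne_zero (hψdiff.analyticAt (isOpen_ball.mem_nhds hzr))]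
        · exact hord _ (hψm hzr) hz0
        · rw [(hψd z hzr).deriv]
          have h1 := one_sub_conj_mul_ne_zero hw' hw'.le
          have h2 := one_sub_conj_mul_ne_zero hw' (mem_ball_zero_iff.1 (hmul hzr)).le
          have h3 : (r : ℂ) ≠ 0 := by exact_mod_cast hr.1.ne'
          exact mul_ne_zero (div_ne_zero h1 (pow_ne_zero _ h2)) h3)
    have hd : HasDerivAt g (deriv g w) (ψ 0) := by
      rw [hψ0]
      exact (hg.differentiableAt (isOpen_ball.mem_nhds (by simpa using hw))).hasDerivAt
    have hψ' : HasDerivAt ψ (((1 - ‖w‖ ^ 2 : ℝ) : ℂ) * r) 0 := by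
      have h1 : HasDerivAt (fun z : ℂ => (r : ℂ) * z) r 0 := by
        simpa using (hasDerivAt_id (0 : ℂ)).const_mul (r : ℂ)
      have h2 : HasDerivAt (blaschke (-w)) ((1 - ‖w‖ ^ 2 : ℝ) : ℂ) ((r : ℂ) * 0) := by
        rw [mul_zero]; exact hasDerivAt_blaschke_neg_zero w
      exact h2.comp 0 h1
    rw [(hd.comp 0 hψ').deriv] at h
    simp only [Function.comp_apply, hψ0, norm_mul, Complex.norm_real, Real.norm_eq_abs] at h
    rw [abs_of_pos (one_sub_norm_sq_pos hw), abs_of_pos hr.1] at h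
    calc r * A = ‖deriv g w‖ * ((1 - ‖w‖ ^ 2) * r) := by simp only [A]; ring
      _ ≤ B := h
  have hlim : Tendsto (fun r : ℝ => r * A) (𝓝[<] 1) (𝓝 (1 * A)) :=
    (Continuous.tendsto (by fun_prop) 1).mono_left nhdsWithin_le_nhds
  rw [one_mul] at hlim
  refine le_of_tendsto hlim ?_
  filter_upwards [Ioo_mem_nhdsLT (zero_lt_one' ℝ)] with r hr using key r hr

/-! ### Path length and induced distances. -/

section InducedDistance

variable {Y : Set ℂ} {c : ℂ → ℝ≥0∞} {x y z : ℂ} {γ : ℝ → ℂ}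

theorem hasDerivWithinAt_of_contDiffOn (hγ : ContDiffOn ℝ 1 γ (Icc 0 1)) {t : ℝ}
    (ht : t ∈ Icc (0 : ℝ) 1) :
    HasDerivWithinAt γ (derivWithin γ (Icc 0 1) t) (Icc 0 1) t :=
  (hγ.differentiableOn one_ne_zero t ht).hasDerivWithinAt

theorem inducedEDist_le (hγ : ContDiffOn ℝ 1 γ (Icc 0 1)) (hY : MapsTo γ (Icc 0 1) Y)
    (h0 : γ 0 = x) (h1 : γ 1 = y) : inducedEDist Y c x y ≤ pathLength c γ :=
  iInf_le_of_le γ (iInf_le_of_le hγ (iInf_le_of_le hY (iInf_le_of_le h0 (iInf_le _ h1))))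

theorem le_inducedEDist {r : ℝ≥0∞} (h : ∀ γ : ℝ → ℂ, ContDiffOn ℝ 1 γ (Icc 0 1) →
    MapsTo γ (Icc 0 1) Y → γ 0 = x → γ 1 = y → r ≤ pathLength c γ) : r ≤ inducedEDist Y c x y :=
  le_iInf fun γ => le_iInf fun h1 => le_iInf fun h2 => le_iInf fun h3 => le_iInf fun h4 =>
    h γ h1 h2 h3 h4

theorem inducedEDist_self (hx : x ∈ Y) : inducedEDist Y c x x = 0 := by
  refine le_antisymm ?_ zero_le
  refine (inducedEDist_le (γ := fun _ => x) contDiffOn_const (fun _ _ => hx) rfl rfl).trans ?_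
  simp [pathLength]

/-- Change of variables in the length integral along a monotone reparametrization. -/
theorem lintegral_speed_comp {φ φ' : ℝ → ℝ} {s : Set ℝ} (hs : MeasurableSet s)
    (hφ : ∀ t, HasDerivAt φ (φ' t) t) (hm : Monotone φ) :
    ∫⁻ t in s, c (γ (φ t)) ^ (1 / 2 : ℝ) * ‖φ' t • derivWithin γ (Icc 0 1) (φ t)‖ₑ =
      ∫⁻ t in φ '' s, c (γ t) ^ (1 / 2 : ℝ) * ‖derivWithin γ (Icc 0 1) t‖ₑ := by
  rw [lintegral_image_eq_lintegral_deriv_mul_of_monotoneOn hs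
    (fun t _ => (hφ t).hasDerivWithinAt) (hm.monotoneOn s)]
  refine lintegral_congr fun t => ?_
  have h0 : 0 ≤ φ' t := by rw [← (hφ t).deriv]; exact hm.deriv_nonneg
  rw [enorm_smul, Real.enorm_eq_ofReal h0]
  ring

/-- The restriction of a path to `[a, b]`, reparametrized. -/
def subpath (γ : ℝ → ℂ) (a b : ℝ) (t : ℝ) : ℂ := γ (a + (b - a) * t)

theorem mapsTo_affine {a b : ℝ} (ha : 0 ≤ a) (hab : a ≤ b) (hb : b ≤ 1) :
    MapsTo (fun t : ℝ => a + (b - a) * t) (Icc 0 1) (Icc 0 1) := fun t ht => by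
  constructor <;> nlinarith [ht.1, ht.2]

theorem contDiffOn_subpath (hγ : ContDiffOn ℝ 1 γ (Icc 0 1)) {a b : ℝ} (ha : 0 ≤ a)
    (hab : a ≤ b) (hb : b ≤ 1) : ContDiffOn ℝ 1 (subpath γ a b) (Icc 0 1) :=
  hγ.comp (by fun_prop) (mapsTo_affine ha hab hb)

theorem pathLength_subpath (hγ : ContDiffOn ℝ 1 γ (Icc 0 1)) {a b : ℝ} (ha : 0 ≤ a)
    (hab : a < b) (hb : b ≤ 1) :
    pathLength c (subpath γ a b) =
      ∫⁻ t in Icc a b, c (γ t) ^ (1 / 2 : ℝ) * ‖derivWithin γ (Icc 0 1) t‖ₑ := by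
  have hd : ∀ t : ℝ, HasDerivAt (fun t : ℝ => a + (b - a) * t) (b - a) t := fun t => by
    simpa using ((hasDerivAt_id t).const_mul (b - a)).const_add a
  have him : (fun t : ℝ => a + (b - a) * t) '' Icc 0 1 = Icc a b := by
    ext s
    constructor
    · rintro ⟨t, ht, rfl⟩
      constructor <;> nlinarith [ht.1, ht.2]
    · rintro ⟨h1, h2⟩
      have hba : 0 < b - a := sub_pos.2 hab
      refine ⟨(s - a) / (b - a), ⟨by apply div_nonneg <;> linarith, ?_⟩, ?_⟩
      · rw [div_le_one hba]; linarith
      · field_simp; ring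
  rw [← him, ← lintegral_speed_comp measurableSet_Icc hd (fun s t h => by
    have : 0 ≤ b - a := by linarith
    gcongr)]
  refine setLIntegral_congr_fun measurableSet_Icc fun t ht => ?_
  have hm := mapsTo_affine ha hab.le hb
  have h1 := (hasDerivWithinAt_of_contDiffOn hγ (hm ht)).scomp t (hd t).hasDerivWithinAt hm
  have h2 : derivWithin (subpath γ a b) (Icc 0 1) t = _ :=
    h1.derivWithin (uniqueDiffOn_Icc zero_lt_one t ht)
  simp only [h2, subpath]

theorem mapsTo_one_sub : MapsTo (fun t : ℝ => 1 - t) (Icc 0 1) (Icc 0 1) := fun t ht =>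
  ⟨by linarith [ht.2], by linarith [ht.1]⟩

theorem contDiffOn_reverse (hγ : ContDiffOn ℝ 1 γ (Icc 0 1)) :
    ContDiffOn ℝ 1 (fun t => γ (1 - t)) (Icc 0 1) :=
  hγ.comp (by fun_prop) mapsTo_one_sub

theorem pathLength_reverse (hγ : ContDiffOn ℝ 1 γ (Icc 0 1)) :
    pathLength c (fun t => γ (1 - t)) = pathLength c γ := by
  have hd : ∀ t : ℝ, HasDerivAt (fun t : ℝ => 1 - t) (-1) t := fun t => by
    simpa using (hasDerivAt_id t).const_sub 1
  have him : (fun t : ℝ => 1 - t) '' Icc 0 1 = Icc 0 1 := by simp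
  have := lintegral_image_eq_lintegral_deriv_mul_of_antitoneOn (s := Icc (0 : ℝ) 1)
    measurableSet_Icc (fun t _ => (hd t).hasDerivWithinAt)
    (fun s _ t _ h => by dsimp only; linarith)
    (fun t => c (γ t) ^ (1 / 2 : ℝ) * ‖derivWithin γ (Icc 0 1) t‖ₑ)
  rw [him] at this
  rw [pathLength, pathLength, this]
  refine setLIntegral_congr_fun measurableSet_Icc fun t ht => ?_
  have h1 := (hasDerivWithinAt_of_contDiffOn hγ (mapsTo_one_sub ht)).scomp t
    (hd t).hasDerivWithinAt mapsTo_one_sub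
  have h2 : derivWithin (fun t => γ (1 - t)) (Icc 0 1) t = _ :=
    h1.derivWithin (uniqueDiffOn_Icc zero_lt_one t ht)
  simp [h2]

theorem inducedEDist_comm_le : inducedEDist Y c y x ≤ inducedEDist Y c x y := by
  refine le_inducedEDist fun γ hγ hY h0 h1 => ?_
  rw [← pathLength_reverse hγ]
  exact inducedEDist_le (contDiffOn_reverse hγ) (hY.comp mapsTo_one_sub) (by simpa using h1)
    (by simpa using h0)

theorem inducedEDist_comm : inducedEDist Y c x y = inducedEDist Y c y x :=
  le_antisymm inducedEDist_comm_le inducedEDist_comm_le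

/-- The length of a path run through by a smooth monotone reparametrization. -/
theorem lintegral_speed_le {φ : ℝ → ℝ} (hφ : ContDiff ℝ 1 φ) (hm : Monotone φ)
    (hφm : ∀ t, φ t ∈ Icc (0 : ℝ) 1) (hγ : ContDiffOn ℝ 1 γ (Icc 0 1)) {η : ℝ → ℂ} {s : Set ℝ}
    (hs : IsOpen s) (hη : EqOn η (γ ∘ φ) s) :
    ∫⁻ t in s, c (η t) ^ (1 / 2 : ℝ) * ‖deriv η t‖ₑ ≤ pathLength c γ := by
  have hd : ∀ t, HasDerivAt φ (deriv φ t) t := fun t =>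
    (hφ.differentiable one_ne_zero t).hasDerivAt
  calc _ = ∫⁻ t in s, c (γ (φ t)) ^ (1 / 2 : ℝ) *
        ‖deriv φ t • derivWithin γ (Icc 0 1) (φ t)‖ₑ := by
        refine setLIntegral_congr_fun hs.measurableSet fun t ht => ?_
        have h1 := (hasDerivWithinAt_of_contDiffOn hγ (hφm t)).scomp_hasDerivAt t (hd t) hφm
        have h2 : η =ᶠ[𝓝 t] γ ∘ φ := eventually_of_mem (hs.mem_nhds ht) hη
        have h3 := h2.deriv_eq.trans h1.deriv
        simp only [h3, hη ht, Function.comp_apply]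
    _ = _ := lintegral_speed_comp hs.measurableSet hd hm
    _ ≤ _ := lintegral_mono_set (by rintro _ ⟨t, -, rfl⟩; exact hφm t)

theorem inducedEDist_triangle :
    inducedEDist Y c x z ≤ inducedEDist Y c x y + inducedEDist Y c y z := by
  have key : ∀ γ₁ γ₂ : ℝ → ℂ, ContDiffOn ℝ 1 γ₁ (Icc 0 1) → ContDiffOn ℝ 1 γ₂ (Icc 0 1) →
      MapsTo γ₁ (Icc 0 1) Y → MapsTo γ₂ (Icc 0 1) Y → γ₁ 0 = x → γ₁ 1 = y → γ₂ 0 = y →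
      γ₂ 1 = z → inducedEDist Y c x z ≤ pathLength c γ₁ + pathLength c γ₂ := by
    intro γ₁ γ₂ hγ₁ hγ₂ hY₁ hY₂ h10 h11 h20 h21
    -- Both paths are slowed to a stop at the junction time `1 / 2`, so that their concatenation is
    -- `C¹` without a corner.
    set φ₁ : ℝ → ℝ := fun t => Real.smoothTransition (2 * t) with hφ₁
    set φ₂ : ℝ → ℝ := fun t => Real.smoothTransition (2 * t - 1) with hφ₂
    have hS : ContDiff ℝ 1 Real.smoothTransition := Real.smoothTransition.contDiff (n := 1)
    have c1 : ContDiff ℝ 1 φ₁ := hS.comp (by fun_prop)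
    have c2 : ContDiff ℝ 1 φ₂ := hS.comp (by fun_prop)
    have m1 : Monotone φ₁ := fun s t h => Real.smoothTransition.monotone (by linarith)
    have m2 : Monotone φ₂ := fun s t h => Real.smoothTransition.monotone (by linarith)
    have i1 : ∀ t, φ₁ t ∈ Icc (0 : ℝ) 1 := fun t =>
      ⟨Real.smoothTransition.nonneg _, Real.smoothTransition.le_one _⟩
    have i2 : ∀ t, φ₂ t ∈ Icc (0 : ℝ) 1 := fun t =>
      ⟨Real.smoothTransition.nonneg _, Real.smoothTransition.le_one _⟩
    have g1 : ContDiff ℝ 1 (γ₁ ∘ φ₁) := hγ₁.comp_contDiff c1 i1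
    have g2 : ContDiff ℝ 1 (γ₂ ∘ φ₂) := hγ₂.comp_contDiff c2 i2
    -- On each half of the interval one summand is constantly `y`, so this sum is the concatenation
    -- and its smoothness needs no case distinction.
    set η : ℝ → ℂ := fun t => (γ₁ ∘ φ₁) t + (γ₂ ∘ φ₂) t - y with hη
    have hηc : ContDiff ℝ 1 η := (g1.add g2).sub contDiff_const
    have e1 : ∀ t ≤ 1 / 2, η t = (γ₁ ∘ φ₁) t := fun t ht => by
      have : φ₂ t = 0 := Real.smoothTransition.zero_of_nonpos (by linarith)
      simp [hη, this, h20]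
    have e2 : ∀ t, 1 / 2 ≤ t → η t = (γ₂ ∘ φ₂) t := fun t ht => by
      have : φ₁ t = 1 := Real.smoothTransition.one_of_one_le (by linarith)
      simp [hη, this, h11]
    have hηY : MapsTo η (Icc 0 1) Y := fun t _ => by
      rcases le_total t (1 / 2) with h | h
      · rw [e1 t h]; exact hY₁ (i1 t)
      · rw [e2 t h]; exact hY₂ (i2 t)
    refine (inducedEDist_le hηc.contDiffOn hηY (by rw [e1 0 (by norm_num)]; simp [hφ₁, h10])
      (by
        rw [e2 1 (by norm_num)]
        have : φ₂ 1 = 1 := Real.smoothTransition.one_of_one_le (by norm_num)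
        simp [this, h21])).trans ?_
    have hlen : pathLength c η = ∫⁻ t in Icc 0 1, c (η t) ^ (1 / 2 : ℝ) * ‖deriv η t‖ₑ :=
      setLIntegral_congr_fun measurableSet_Icc fun t ht => by
        simp only [(hηc.differentiable one_ne_zero t).derivWithin
          (uniqueDiffOn_Icc zero_lt_one t ht)]
    rw [hlen, ← Icc_union_Icc_eq_Icc (show (0 : ℝ) ≤ 1 / 2 by norm_num) (by norm_num)]
    refine (lintegral_union_le _ _ _).trans (add_le_add ?_ ?_)
    · rw [← restrict_Ioo_eq_restrict_Icc]
      exact lintegral_speed_le c1 m1 i1 hγ₁ isOpen_Ioo fun t ht => e1 t ht.2.le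
    · rw [← restrict_Ioo_eq_restrict_Icc]
      exact lintegral_speed_le c2 m2 i2 hγ₂ isOpen_Ioo fun t ht => e2 t ht.1.le
  rw [← tsub_le_iff_right]
  refine le_inducedEDist fun γ₁ hγ₁ hY₁ h10 h11 => ?_
  rw [tsub_le_iff_left, add_comm, ← tsub_le_iff_left]
  refine le_inducedEDist fun γ₂ hγ₂ hY₂ h20 h21 => ?_
  rw [tsub_le_iff_left]
  exact key γ₁ γ₂ hγ₁ hγ₂ hY₁ hY₂ h10 h11 h20 h21

/-- Chain rule for the composition of a path with a holomorphic function. -/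
theorem derivWithin_comp_path {g : ℂ → ℂ} (hγ : ContDiffOn ℝ 1 γ (Icc 0 1)) {t : ℝ}
    (ht : t ∈ Icc (0 : ℝ) 1) (hg : DifferentiableAt ℂ g (γ t)) :
    derivWithin (g ∘ γ) (Icc 0 1) t = deriv g (γ t) * derivWithin γ (Icc 0 1) t :=
  (hg.hasDerivAt.comp_hasDerivWithinAt t (hasDerivWithinAt_of_contDiffOn hγ ht)).derivWithin
    (uniqueDiffOn_Icc zero_lt_one t ht)

theorem contDiffOn_comp_path {g : ℂ → ℂ} {U : Set ℂ} (hU : IsOpen U)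
    (hg : DifferentiableOn ℂ g U) (hγ : ContDiffOn ℝ 1 γ (Icc 0 1)) (hγU : MapsTo γ (Icc 0 1) U) :
    ContDiffOn ℝ 1 (g ∘ γ) (Icc 0 1) :=
  ((hg.contDiffOn hU (n := 1)).restrict_scalars ℝ).comp hγ hγU

/-- A holomorphic map that contracts the metrics contracts the induced distances. -/
theorem inducedEDist_map_le {c' : ℂ → ℝ≥0∞} {g : ℂ → ℂ} {U : Set ℂ} (hU : IsOpen U)
    (hg : DifferentiableOn ℂ g U) (hgY : MapsTo g U Y)
    (hc : ∀ z ∈ U, c' (g z) ^ (1 / 2 : ℝ) * ‖deriv g z‖ₑ ≤ c z ^ (1 / 2 : ℝ)) :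
    inducedEDist Y c' (g x) (g y) ≤ inducedEDist U c x y := by
  refine le_inducedEDist fun γ hγ hγU h0 h1 => ?_
  refine (inducedEDist_le (γ := g ∘ γ) (contDiffOn_comp_path hU hg hγ hγU) (hgY.comp hγU)
    (by simp [h0]) (by simp [h1])).trans ?_
  refine setLIntegral_mono' measurableSet_Icc fun t ht => ?_
  rw [derivWithin_comp_path hγ ht (hg.differentiableAt (hU.mem_nhds (hγU ht))), enorm_mul,
    ← mul_assoc]
  exact mul_le_mul_left (hc _ (hγU ht)) _

end InducedDistance

/-! ### The orbifold metric and its contraction property. -/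

theorem mem_unitDisk {z : ℂ} : z ∈ unitDisk ↔ ‖z‖ < 1 := mem_ball_zero_iff

theorem isOpen_unitDisk : IsOpen unitDisk := isOpen_ball

theorem four_div_ofReal_sq_rpow {W : ℝ} (hW : 0 < W) :
    (4 / ENNReal.ofReal (W ^ 2)) ^ (1 / 2 : ℝ) = ENNReal.ofReal (2 / W) := by
  have h4 : (4 : ℝ≥0∞) = ENNReal.ofReal 4 := by simp
  rw [h4, ← ENNReal.ofReal_div_of_pos (by positivity),
    ENNReal.ofReal_rpow_of_nonneg (by positivity) (by norm_num), ← Real.sqrt_eq_rpow]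
  congr 1
  rw [show 4 / W ^ 2 = (2 / W) ^ 2 by rw [div_pow]; norm_num, Real.sqrt_sq (by positivity)]

/-- The function `W` with `ω = 4 dz dz̄ / W(z)²` away from the origin. -/
def orbifoldWeight : ℕ∞ → ℂ → ℝ
  | (n : ℕ), z => ‖z‖ * (2 * n * Real.sinh (-Real.log ‖z‖ / n))
  | ⊤, z => ‖z‖ * (2 * -Real.log ‖z‖)

theorem orbifoldWeight_natCast (n : ℕ) (z : ℂ) :
    orbifoldWeight n z = ‖z‖ * (2 * n * Real.sinh (-Real.log ‖z‖ / n)) := rfl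

theorem orbifoldWeight_top (z : ℂ) : orbifoldWeight ⊤ z = ‖z‖ * (2 * -Real.log ‖z‖) := rfl

theorem orbifoldCoeff_natCast (n : ℕ) (z : ℂ) : orbifoldCoeff n z = 4 / ENNReal.ofReal
    ((n : ℝ) ^ 2 * ‖z‖ ^ (2 - 2 / (n : ℝ)) * (1 - ‖z‖ ^ (2 / (n : ℝ))) ^ 2) := rfl

theorem orbifoldCoeff_top (z : ℂ) :
    orbifoldCoeff ⊤ z = 4 / ENNReal.ofReal (‖z‖ ^ 2 * Real.log (‖z‖ ^ 2) ^ 2) := rfl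

theorem orbifoldWeight_pos {n : ℕ∞} (hn : 0 < n) {z : ℂ} (h0 : z ≠ 0) (h1 : ‖z‖ < 1) :
    0 < orbifoldWeight n z := by
  have hz : 0 < ‖z‖ := norm_pos_iff.2 h0
  have hl : 0 < -Real.log ‖z‖ := neg_pos.2 (Real.log_neg hz h1)
  induction n using ENat.recTopCoe with
  | top => rw [orbifoldWeight_top]; positivity
  | coe n =>
    have hn' : (0 : ℝ) < n := by exact_mod_cast hn
    have := Real.sinh_pos_iff.2 (div_pos hl hn')
    rw [orbifoldWeight_natCast]; positivity

/-- For finite `n`, `|z|^(1 - 1/n) (1 - |z|^(2/n)) = |z| (|z|^(-1/n) - |z|^(1/n))`, and the last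
bracket is `2 sinh(-log|z| / n)`. -/
theorem orbifoldCoeff_rpow {n : ℕ∞} (hn : 0 < n) {z : ℂ} (h0 : z ≠ 0) (h1 : ‖z‖ < 1) :
    orbifoldCoeff n z ^ (1 / 2 : ℝ) = ENNReal.ofReal (2 / orbifoldWeight n z) := by
  rw [← four_div_ofReal_sq_rpow (orbifoldWeight_pos hn h0 h1)]
  have hz : 0 < ‖z‖ := norm_pos_iff.2 h0
  congr 3
  induction n using ENat.recTopCoe with
  | top =>
    rw [orbifoldCoeff_top, orbifoldWeight_top, Real.log_pow]
    congr 2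
    push_cast; ring
  | coe n =>
    have hn' : (0 : ℝ) < n := by exact_mod_cast hn
    rw [orbifoldCoeff_natCast, orbifoldWeight_natCast]
    congr 2
    set l := Real.log ‖z‖ with hl
    have e : ∀ a : ℝ, ‖z‖ ^ a = Real.exp (l * a) := fun a => Real.rpow_def_of_pos hz a
    have e1 : ‖z‖ ^ (2 - 2 / (n : ℝ)) = ‖z‖ ^ 2 * Real.exp (-l / n) ^ 2 := by
      rw [Real.rpow_sub hz, Real.rpow_two, e, div_eq_mul_inv, ← Real.exp_neg, ← Real.exp_nat_mul]
      congr 2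
      push_cast; ring
    have e2 : ‖z‖ ^ (2 / (n : ℝ)) = Real.exp (l / n) ^ 2 := by
      rw [e, ← Real.exp_nat_mul]
      congr 1
      push_cast; ring
    have e3 : Real.exp (-l / n) * Real.exp (l / n) = 1 := by
      rw [← Real.exp_add]; simp; ring
    rw [e1, e2, Real.sinh_eq, neg_div, neg_neg]
    rw [neg_div] at e3
    have : Real.exp (-(l / n)) * (1 - Real.exp (l / n) ^ 2)
        = Real.exp (-(l / n)) - Real.exp (l / n) := by
      linear_combination (-Real.exp (l / n)) * e3
    calc _ = ((n : ℝ) * ‖z‖ * (Real.exp (-(l / n)) * (1 - Real.exp (l / n) ^ 2))) ^ 2 := by ring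
      _ = _ := by rw [this]; ring

theorem poincareCoeff_rpow {z : ℂ} (h1 : ‖z‖ < 1) :
    poincareCoeff z ^ (1 / 2 : ℝ) = ENNReal.ofReal (2 / (1 - ‖z‖ ^ 2)) :=
  four_div_ofReal_sq_rpow (one_sub_norm_sq_pos h1)

section OrbifoldDisk

variable {n : ℕ∞} {hn : 0 < n}

theorem orbifoldDisk_mult_zero : (orbifoldDisk n hn).mult 0 = n := if_pos rfl

theorem orbifoldDisk_mult_of_ne {p : ℂ} (hp : p ≠ 0) : (orbifoldDisk n hn).mult p = 1 := if_neg hp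

theorem eq_zero_of_mem_supp {p : ℂ} (hp : p ∈ (orbifoldDisk n hn).supp) : p = 0 := by
  by_contra h
  exact hp (orbifoldDisk_mult_of_ne h)

theorem zero_mem_supp (h : n ≠ 1) : (0 : ℂ) ∈ (orbifoldDisk n hn).supp := by
  change (orbifoldDisk n hn).mult 0 ≠ 1
  rwa [orbifoldDisk_mult_zero]

theorem mem_points_iff {p : ℂ} :
    p ∈ (orbifoldDisk n hn).carrier \ (orbifoldDisk n hn).deltaOne ↔
      ‖p‖ < 1 ∧ (n = ⊤ → p ≠ 0) := by
  refine and_congr mem_unitDisk ?_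
  change (orbifoldDisk n hn).mult p ≠ ⊤ ↔ _
  by_cases hp : p = 0
  · subst hp; simp [orbifoldDisk_mult_zero]
  · simp [orbifoldDisk_mult_of_ne hp, hp]

/-- A multiple of `mult p` is at least `mult p` unless it is zero, and the order is nonzero because
`h - p` vanishes at `x`. -/
theorem PlaneOrbifold.IsClassicalOrbifoldMorphism.isOrbifoldMorphism {X : PlaneOrbifold}
    {h : ℂ → ℂ} (H : X.IsClassicalOrbifoldMorphism h) : X.IsOrbifoldMorphism h where
  differentiableOn := H.differentiableOn
  mapsTo := H.mapsTo
  not_subset := H.not_subset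
  le_order p hp hp' x hx hxp := by
    obtain ⟨k, hk⟩ := H.dvd_order p hp hp' x hx hxp
    rw [hk]
    refine le_mul_of_one_le_right zero_le (Order.one_le_iff_ne_zero.2 ?_)
    rintro rfl
    have han : AnalyticAt ℂ (fun t => h t - p) x :=
      (H.differentiableOn.analyticAt (isOpen_unitDisk.mem_nhds hx)).fun_sub analyticAt_const
    rw [mul_zero, han.analyticOrderAt_eq_zero] at hk
    exact hk (sub_eq_zero.2 hxp)
  avoids := H.avoids

theorem le_analyticOrderAt_of_isOrbifoldMorphism {N : ℕ} {hN : (0 : ℕ∞) < (N : ℕ∞)} {g : ℂ → ℂ}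
    (hg : (orbifoldDisk N hN).IsOrbifoldMorphism g) {z : ℂ} (hz : z ∈ unitDisk) (h0 : g z = 0) :
    (N : ℕ∞) ≤ analyticOrderAt g z := by
  by_cases h1 : (N : ℕ∞) = 1
  · rw [h1, Order.one_le_iff_ne_zero, Ne,
      (hg.differentiableOn.analyticAt (isOpen_unitDisk.mem_nhds hz)).analyticOrderAt_eq_zero]
    simpa using h0
  · have := hg.le_order 0 (zero_mem_supp h1) (by simp [orbifoldDisk_mult_zero]) z hz h0
    simpa [orbifoldDisk_mult_zero] using this

/-- Orbifold morphisms contract the Poincaré metric to the orbifold metric. -/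
theorem orbifoldCoeff_mul_deriv_le {g : ℂ → ℂ} (hg : (orbifoldDisk n hn).IsOrbifoldMorphism g)
    {z : ℂ} (hz : z ∈ unitDisk) :
    orbifoldCoeff n (g z) ^ (1 / 2 : ℝ) * ‖deriv g z‖ₑ ≤ poincareCoeff z ^ (1 / 2 : ℝ) := by
  have hz1 := mem_unitDisk.1 hz
  have hgz : ‖g z‖ < 1 := mem_unitDisk.1 (hg.mapsTo hz)
  have hd : DifferentiableOn ℂ g (ball 0 1) := hg.differentiableOn
  have hb : ∀ z ∈ ball (0 : ℂ) 1, ‖g z‖ ≤ 1 := fun z hz => (mem_unitDisk.1 (hg.mapsTo hz)).le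
  have hP := one_sub_norm_sq_pos hz1
  rw [poincareCoeff_rpow hz1]
  by_cases h0 : g z = 0
  · induction n using ENat.recTopCoe with
    | top => exact absurd h0 (hg.avoids 0 orbifoldDisk_mult_zero z hz)
    | coe N =>
      by_cases h1 : N = 1
      · subst h1
        have hs := schwarz_of_eq_zero hd hb hz1 h0
        -- For `n = 1` the factor `‖0‖ ^ (2 - 2 / 1)` is `0 ^ 0 = 1`, so the coefficient is finite
        -- at the origin.
        have hc : orbifoldCoeff (1 : ℕ) 0 = 4 / ENNReal.ofReal (1 ^ 2) := by
          rw [orbifoldCoeff_natCast]; norm_num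
        rw [h0, hc, four_div_ofReal_sq_rpow one_pos, ← ofReal_norm, ← ENNReal.ofReal_mul (by simp)]
        refine ENNReal.ofReal_le_ofReal ?_
        rw [le_div_iff₀ hP]
        linarith
      -- At a zero of order at least `2` the derivative vanishes, and `⊤ * 0 = 0` absorbs the
      -- infinite coefficient.
      · have hord := le_analyticOrderAt_of_isOrbifoldMorphism hg hz h0
        have hder : deriv g z = 0 := by
          by_contra hne
          have han := hd.analyticAt (isOpen_unitDisk.mem_nhds hz)
          have := han.analyticOrderAt_sub_eq_one_of_deriv_ne_zero hne
          simp only [h0, sub_zero] at this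
          rw [this] at hord
          have h2 : N ≤ 1 := by exact_mod_cast hord
          have h3 : 0 < N := by exact_mod_cast hn
          omega
        simp [hder]
  · rw [orbifoldCoeff_rpow hn h0 hgz]
    have hW := orbifoldWeight_pos hn h0 hgz
    have hs : ‖deriv g z‖ * (1 - ‖z‖ ^ 2) ≤ orbifoldWeight n (g z) := by
      induction n using ENat.recTopCoe with
      | top =>
        exact schwarz_of_forall_ne_zero hd hb
          (fun w hw => hg.avoids 0 orbifoldDisk_mult_zero w hw) hz1
      | coe N =>
        exact schwarz_of_le_order (by exact_mod_cast hn) hd hb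
          (fun w hw => le_analyticOrderAt_of_isOrbifoldMorphism hg hw) hz1 h0
    rw [← ofReal_norm, ← ENNReal.ofReal_mul (by positivity)]
    refine ENNReal.ofReal_le_ofReal ?_
    rw [le_div_iff₀ hP, div_mul_eq_mul_div, div_mul_eq_mul_div, div_le_iff₀ hW]
    linarith

end OrbifoldDisk

/-- A `C¹` path avoiding the origin has a `C¹` logarithm. -/
theorem exists_log_path {γ : ℝ → ℂ} (hγ : ContDiffOn ℝ 1 γ (Icc 0 1))
    (h0 : ∀ t ∈ Icc (0 : ℝ) 1, γ t ≠ 0) :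
    ∃ l : ℝ → ℂ, ContDiff ℝ 1 l ∧ ∀ t ∈ Icc (0 : ℝ) 1, Complex.exp (l t) = γ t := by
  have hf : ContinuousOn (fun t => derivWithin γ (Icc 0 1) t / γ t) (Icc 0 1) :=
    (hγ.continuousOn_derivWithin (uniqueDiffOn_Icc zero_lt_one) le_rfl).div hγ.continuousOn h0
  -- Extending `γ' / γ` by constants makes it continuous on `ℝ`, so its primitive is `C¹` on the
  -- whole line.
  set F : ℝ → ℂ := IccExtend zero_le_one
    ((Icc (0 : ℝ) 1).domRestrict fun t => derivWithin γ (Icc 0 1) t / γ t) with hF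
  have hFc : Continuous F := (continuousOn_iff_continuous_domRestrict.1 hf).Icc_extend'
  set l : ℝ → ℂ := fun t => Complex.log (γ 0) + ∫ s in (0 : ℝ)..t, F s with hl
  have hld : ∀ t, HasDerivAt l (F t) t := fun t =>
    (intervalIntegral.integral_hasDerivAt_right (hFc.intervalIntegrable _ _)
      (hFc.stronglyMeasurableAtFilter _ _) hFc.continuousAt).const_add _
  have hlc : ContDiff ℝ 1 l := by
    rw [contDiff_one_iff_deriv]
    refine ⟨fun t => (hld t).differentiableAt, ?_⟩
    rw [show deriv l = F from funext fun t => (hld t).deriv]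
    exact hFc
  refine ⟨l, hlc, ?_⟩
  have z0 : (0 : ℝ) ∈ Icc (0 : ℝ) 1 := by simp
  have hk : ∀ t ∈ Icc (0 : ℝ) 1, HasDerivWithinAt (fun t => γ t * Complex.exp (-l t)) 0
      (Icc 0 1) t := fun t ht => by
    have h1 := hasDerivWithinAt_of_contDiffOn hγ ht
    have h2 := h1.mul (hld t).neg.cexp.hasDerivWithinAt
    convert! h2 using 1
    have hFt : F t = derivWithin γ (Icc 0 1) t / γ t := by
      rw [hF, IccExtend_of_mem _ _ ht]; rfl
    have := h0 t ht
    rw [hFt]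
    field_simp
    ring
  intro t ht
  have hc := constant_of_derivWithin_zero (fun t ht => (hk t ht).differentiableWithinAt)
    (fun t ht => (hk t (Ico_subset_Icc_self ht)).derivWithin
      (uniqueDiffOn_Icc zero_lt_one t (Ico_subset_Icc_self ht))) t ht
  have hl0 : l 0 = Complex.log (γ 0) := by simp [hl]
  simp only [hl0, Complex.exp_neg, Complex.exp_log (h0 0 z0)] at hc
  rw [mul_inv_cancel₀ (h0 0 z0)] at hc
  have he := Complex.exp_ne_zero (l t)
  field_simp at hc
  exact hc.symm

/-- An orbifold covering of the orbifold disk by the unit disk, given with a lift `q` of the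
exponential map on the left half-plane. -/
structure IsDiskCovering (n : ℕ∞) (hn : 0 < n) (p q : ℂ → ℂ) : Prop where
  isClassicalOrbifoldMorphism : (orbifoldDisk n hn).IsClassicalOrbifoldMorphism p
  differentiableOn_lift : DifferentiableOn ℂ q {ζ | ζ.re < 0}
  mapsTo_lift : MapsTo q {ζ | ζ.re < 0} unitDisk
  apply_lift : ∀ ζ : ℂ, ζ.re < 0 → p (q ζ) = Complex.exp ζ
  weight_le : ∀ z ∈ unitDisk, p z ≠ 0 → orbifoldWeight n (p z) ≤ ‖deriv p z‖ * (1 - ‖z‖ ^ 2)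

/-! ### The extremal coverings `z ^ N` and `exp ((z + 1) / (z - 1))`. -/

section Coverings

theorem analyticOrderAt_pow_id (N : ℕ) : analyticOrderAt (fun t : ℂ => t ^ N) 0 = N := by
  have h : AnalyticAt ℂ (fun t : ℂ => t ^ N) 0 := by fun_prop
  rw [h.analyticOrderAt_eq_natCast]
  exact ⟨fun _ => 1, analyticAt_const, one_ne_zero, by simp⟩

theorem half_mem_unitDisk : (1 / 2 : ℂ) ∈ unitDisk := by
  rw [mem_unitDisk]; norm_num

/-- The covering `z ↦ z ^ N` for finite multiplicity `N`. -/
theorem isDiskCovering_pow {N : ℕ} (hN : (0 : ℕ∞) < (N : ℕ∞)) :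
    IsDiskCovering N hN (fun z => z ^ N) fun ζ => Complex.exp (ζ / N) := by
  have hN0 : 0 < N := by exact_mod_cast hN
  have hN' : (0 : ℝ) < N := by exact_mod_cast hN0
  refine ⟨⟨by fun_prop, ?_, ?_, ?_, ?_⟩, by fun_prop, ?_, ?_, ?_⟩
  · intro z hz
    change z ^ N ∈ unitDisk
    rw [mem_unitDisk] at hz ⊢
    rw [norm_pow]
    exact pow_lt_one₀ (norm_nonneg _) hz hN0.ne'
  · intro h
    have := eq_zero_of_mem_supp (h ⟨1 / 2, half_mem_unitDisk, rfl⟩)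
    simp at this
  · intro p hp _ x _ hxp
    obtain rfl := eq_zero_of_mem_supp hp
    obtain rfl : x = 0 := by simpa [hN0.ne'] using hxp
    simp only [sub_zero, analyticOrderAt_pow_id, orbifoldDisk_mult_zero]
    exact dvd_rfl
  · intro p hp x _ _
    by_cases h0 : p = 0
    · subst h0; simp [orbifoldDisk_mult_zero] at hp
    · simp [orbifoldDisk_mult_of_ne h0] at hp
  · intro ζ hζ
    rw [mem_unitDisk, Complex.norm_exp, Real.exp_lt_one_iff]
    have : (ζ / N).re = ζ.re / N := Complex.div_natCast_re ζ N
    rw [this]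
    exact div_neg_of_neg_of_pos hζ hN'
  · intro ζ _
    have : (N : ℂ) ≠ 0 := by exact_mod_cast hN0.ne'
    rw [← Complex.exp_nat_mul]
    congr 1
    field_simp
  · intro z hz hz0
    have hz' : z ≠ 0 := fun h => hz0 (by simp [h, hN0.ne'])
    have hp : 0 < ‖z‖ := norm_pos_iff.2 hz'
    -- Equality in the Schwarz inequality: `-log(|z|^N) / N = -log|z|`, so `W(z^N) = N |z|^(N-1) (1
    -- - |z|²)`.
    rw [orbifoldWeight_natCast, norm_pow, Real.log_pow, ← mul_neg, mul_div_cancel_left₀ _ hN'.ne',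
      Real.sinh_eq, neg_neg, Real.exp_neg, Real.exp_log hp]
    have hd : deriv (fun z : ℂ => z ^ N) z = N * z ^ (N - 1) := by simp
    rw [hd, norm_mul, norm_pow, Complex.norm_natCast, ← pow_sub_one_mul hN0.ne' ‖z‖]
    apply le_of_eq
    field_simp

theorem sub_one_ne_zero_of_mem_unitDisk {z : ℂ} (hz : z ∈ unitDisk) : z - 1 ≠ 0 := by
  intro h
  rw [mem_unitDisk, sub_eq_zero.1 h] at hz
  simp at hz

theorem cayley_re (z : ℂ) :
    ((z + 1) / (z - 1)).re = (‖z‖ ^ 2 - 1) / ‖z - 1‖ ^ 2 := by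
  rw [Complex.div_re, Complex.sq_norm, Complex.sq_norm, ← add_div]
  congr 1
  simp [Complex.normSq_apply]
  ring

theorem cayley_re_neg {z : ℂ} (hz : z ∈ unitDisk) : ((z + 1) / (z - 1)).re < 0 := by
  have h := sub_one_ne_zero_of_mem_unitDisk hz
  rw [cayley_re]
  have := one_sub_norm_sq_pos (mem_unitDisk.1 hz)
  exact div_neg_of_neg_of_pos (by linarith) (pow_pos (norm_pos_iff.2 h) 2)

/-- The universal covering of the punctured disk. -/
theorem isDiskCovering_exp (hn : (0 : ℕ∞) < ⊤) :
    IsDiskCovering ⊤ hn (fun z => Complex.exp ((z + 1) / (z - 1)))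
      fun ζ => (ζ + 1) / (ζ - 1) := by
  have hd : ∀ z ∈ unitDisk, HasDerivAt (fun z : ℂ => Complex.exp ((z + 1) / (z - 1)))
      (Complex.exp ((z + 1) / (z - 1)) * (-2 / (z - 1) ^ 2)) z := fun z hz => by
    have h1 : HasDerivAt (fun z : ℂ => z + 1) 1 z := (hasDerivAt_id z).add_const 1
    have h2 : HasDerivAt (fun z : ℂ => z - 1) 1 z := (hasDerivAt_id z).sub_const 1
    convert! (h1.div h2 (sub_one_ne_zero_of_mem_unitDisk hz)).cexp using 3
    ring
  have hne : ∀ ζ : ℂ, ζ.re < 0 → ζ - 1 ≠ 0 := fun ζ hζ h => by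
    have := congrArg Complex.re h
    simp at this
    linarith
  refine ⟨⟨fun z hz => (hd z hz).differentiableAt.differentiableWithinAt, ?_, ?_, ?_, ?_⟩,
    ?_, ?_, ?_, ?_⟩
  · intro z hz
    change Complex.exp _ ∈ unitDisk
    rw [mem_unitDisk, Complex.norm_exp, Real.exp_lt_one_iff]
    exact cayley_re_neg hz
  · intro h
    exact Complex.exp_ne_zero _ (eq_zero_of_mem_supp (h ⟨1 / 2, half_mem_unitDisk, rfl⟩))
  · intro p hp _ x _ hxp
    rw [eq_zero_of_mem_supp hp] at hxp
    exact absurd hxp (Complex.exp_ne_zero _)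
  · intro p hp x _ hxp
    by_cases h0 : p = 0
    · subst h0; exact Complex.exp_ne_zero _ hxp
    · simp [orbifoldDisk_mult_of_ne h0] at hp
  · intro ζ hζ
    have := hne ζ hζ
    exact DifferentiableAt.differentiableWithinAt (by fun_prop (disch := assumption))
  · intro ζ hζ
    have hζ' : ζ.re < 0 := hζ
    have h1 : 0 < ‖ζ - 1‖ := norm_pos_iff.2 (hne ζ hζ')
    rw [mem_unitDisk, norm_div, div_lt_one h1]
    refine lt_of_pow_lt_pow_left₀ 2 h1.le ?_
    rw [Complex.sq_norm, Complex.sq_norm]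
    simp only [Complex.normSq_apply, Complex.add_re, Complex.add_im, Complex.sub_re,
      Complex.sub_im, Complex.one_re, Complex.one_im]
    nlinarith
  · intro ζ hζ
    have h1 := hne ζ hζ
    -- The Cayley map exchanging the disk and the left half-plane is its own inverse.
    congr 1
    have h2 : (ζ + 1) / (ζ - 1) + 1 = 2 * ζ / (ζ - 1) := by field_simp; ring
    have h3 : (ζ + 1) / (ζ - 1) - 1 = 2 / (ζ - 1) := by field_simp; ring
    rw [h2, h3]
    field_simp
  · intro z hz _
    rw [orbifoldWeight_top, (hd z hz).deriv, norm_mul, Complex.norm_exp, Real.log_exp,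
      cayley_re, norm_div, norm_neg, norm_pow, Complex.norm_ofNat]
    apply le_of_eq
    ring

end Coverings

/-! ### Decreasing pseudo-distances and paths avoiding the origin. -/

section UpperBound

variable {n : ℕ∞} {hn : 0 < n} {p q : ℂ → ℂ}

/-- This is `weight_le` in terms of the two metrics; it makes a lifted path no longer than the path
below it. -/
theorem IsDiskCovering.poincareCoeff_rpow_le (hp : IsDiskCovering n hn p q) {z : ℂ}
    (hz : z ∈ unitDisk) (h0 : p z ≠ 0) :
    poincareCoeff z ^ (1 / 2 : ℝ) ≤ orbifoldCoeff n (p z) ^ (1 / 2 : ℝ) * ‖deriv p z‖ₑ := by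
  have hz1 := mem_unitDisk.1 hz
  have hpz := mem_unitDisk.1 (hp.isClassicalOrbifoldMorphism.mapsTo hz)
  have hW := orbifoldWeight_pos hn h0 hpz
  have hP := one_sub_norm_sq_pos hz1
  have hle := hp.weight_le z hz h0
  rw [poincareCoeff_rpow hz1, orbifoldCoeff_rpow hn h0 hpz, ← ofReal_norm,
    ← ENNReal.ofReal_mul (by positivity)]
  refine ENNReal.ofReal_le_ofReal ?_
  rw [div_le_iff₀ hP, div_mul_eq_mul_div, div_mul_eq_mul_div, le_div_iff₀ hW]
  linarith

variable {d : (orbifoldDisk n hn).Points → (orbifoldDisk n hn).Points → ℝ}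

/-- A decreasing pseudo-distance is bounded by the lengths of the paths that avoid the origin. -/
theorem ofReal_le_pathLength_of_ne_zero (hp : IsDiskCovering n hn p q)
    (hd : d ∈ (orbifoldDisk n hn).classicalDecreasingPseudoDists) {γ : ℝ → ℂ}
    (hγ : ContDiffOn ℝ 1 γ (Icc 0 1)) (hγD : MapsTo γ (Icc 0 1) unitDisk)
    (hγ0 : ∀ t ∈ Icc (0 : ℝ) 1, γ t ≠ 0) {x y : (orbifoldDisk n hn).Points} (hx : γ 0 = x)
    (hy : γ 1 = y) : ENNReal.ofReal (d x y) ≤ pathLength (orbifoldCoeff n) γ := by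
  -- The lift of `γ` to the disk is `q ∘ l`: the logarithm stays in the left half-plane because `γ`
  -- stays in the unit disk.
  obtain ⟨l, hl, hexp⟩ := exists_log_path hγ hγ0
  have hre : MapsTo l (Icc 0 1) {ζ | ζ.re < 0} := fun t ht => by
    have := hγD ht
    rwa [← hexp t ht, mem_unitDisk, Complex.norm_exp, Real.exp_lt_one_iff] at this
  have hopen : IsOpen {ζ : ℂ | ζ.re < 0} := isOpen_lt Complex.continuous_re continuous_const
  have hc : ContDiffOn ℝ 1 (q ∘ l) (Icc 0 1) :=
    contDiffOn_comp_path hopen hp.differentiableOn_lift hl.contDiffOn hre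
  have hm : MapsTo (q ∘ l) (Icc 0 1) unitDisk := hp.mapsTo_lift.comp hre
  have hpq : ∀ t ∈ Icc (0 : ℝ) 1, p ((q ∘ l) t) = γ t := fun t ht => by
    rw [← hexp t ht]; exact hp.apply_lift _ (hre ht)
  have z0 : (0 : ℝ) ∈ Icc (0 : ℝ) 1 := by simp
  have z1 : (1 : ℝ) ∈ Icc (0 : ℝ) 1 := by simp
  have hbound := hd.2 p hp.isClassicalOrbifoldMorphism _ _ (hm z0) (hm z1)
  have ex : (⟨p ((q ∘ l) 0), hp.isClassicalOrbifoldMorphism.mem (hm z0)⟩ :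
      (orbifoldDisk n hn).Points) = x := Subtype.ext ((hpq 0 z0).trans hx)
  have ey : (⟨p ((q ∘ l) 1), hp.isClassicalOrbifoldMorphism.mem (hm z1)⟩ :
      (orbifoldDisk n hn).Points) = y := Subtype.ext ((hpq 1 z1).trans hy)
  rw [ex, ey] at hbound
  refine hbound.trans ((inducedEDist_le hc hm rfl rfl).trans ?_)
  refine setLIntegral_mono' measurableSet_Icc fun t ht => ?_
  have hder : derivWithin γ (Icc 0 1) t
      = deriv p ((q ∘ l) t) * derivWithin (q ∘ l) (Icc 0 1) t := by
    have hpd := hp.isClassicalOrbifoldMorphism.differentiableOn.differentiableAt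
      (isOpen_unitDisk.mem_nhds (hm ht))
    rw [← derivWithin_comp_path hc ht hpd]
    exact derivWithin_congr (fun s hs => (hpq s hs).symm) (hpq t ht).symm
  rw [hder, enorm_mul, ← mul_assoc, ← hpq t ht]
  exact mul_le_mul_left (hp.poincareCoeff_rpow_le (hm ht) (by rw [hpq t ht]; exact hγ0 t ht)) _

/-- The radial segment has length at most its Euclidean length times the largest density on it. This
crude bound suffices for finiteness and for continuity at `0`. -/
theorem poincareEDist_zero_le {z : ℂ} (hz : z ∈ unitDisk) :
    poincareEDist z 0 ≤ ENNReal.ofReal (2 / (1 - ‖z‖ ^ 2) * ‖z‖) := by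
  have hz1 := mem_unitDisk.1 hz
  have hP := one_sub_norm_sq_pos hz1
  have hle : ∀ t ∈ Icc (0 : ℝ) 1, ‖(t : ℂ) * z‖ ≤ ‖z‖ := fun t ht => by
    rw [norm_mul, Complex.norm_real, Real.norm_eq_abs, abs_of_nonneg ht.1]
    exact mul_le_of_le_one_left (norm_nonneg _) ht.2
  have hd : ∀ t : ℝ, HasDerivAt (fun t : ℝ => (t : ℂ) * z) z t := fun t => by
    simpa using (Complex.ofRealCLM.hasDerivAt (x := t)).mul_const z
  rw [poincareEDist, inducedEDist_comm]
  refine (inducedEDist_le (γ := fun t : ℝ => (t : ℂ) * z)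
    (ContDiff.contDiffOn (Complex.ofRealCLM.contDiff.mul contDiff_const))
    (fun t ht => mem_unitDisk.2 ((hle t ht).trans_lt hz1)) (by simp) (by simp)).trans ?_
  calc pathLength poincareCoeff (fun t : ℝ => (t : ℂ) * z)
      ≤ ∫⁻ _ in Icc (0 : ℝ) 1, ENNReal.ofReal (2 / (1 - ‖z‖ ^ 2) * ‖z‖) := by
        refine setLIntegral_mono' measurableSet_Icc fun t ht => ?_
        rw [poincareCoeff_rpow ((hle t ht).trans_lt hz1), (hd t).hasDerivWithinAt.derivWithin
          (uniqueDiffOn_Icc zero_lt_one t ht), ← ofReal_norm, ← ENNReal.ofReal_mul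
          (by have := one_sub_norm_sq_pos ((hle t ht).trans_lt hz1); positivity)]
        have := hle t ht
        gcongr
    _ = _ := by simp

theorem poincareEDist_ne_top {z w : ℂ} (hz : z ∈ unitDisk) (hw : w ∈ unitDisk) :
    poincareEDist z w ≠ ⊤ := by
  refine ne_top_of_le_ne_top ?_ (inducedEDist_triangle (y := 0))
  refine ENNReal.add_ne_top.2 ⟨?_, ?_⟩
  · exact ne_top_of_le_ne_top ENNReal.ofReal_ne_top (poincareEDist_zero_le hz)
  · rw [inducedEDist_comm]
    exact ne_top_of_le_ne_top ENNReal.ofReal_ne_top (poincareEDist_zero_le hw)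

end UpperBound

/-! ### Paths through the origin, for finite multiplicity. -/

section FiniteMultiplicity

variable {N : ℕ} {hN : (0 : ℕ∞) < (N : ℕ∞)}
  {d : (orbifoldDisk N hN).Points → (orbifoldDisk N hN).Points → ℝ}

theorem mem_points_natCast_iff {p : ℂ} :
    p ∈ (orbifoldDisk N hN).carrier \ (orbifoldDisk N hN).deltaOne ↔ p ∈ unitDisk := by
  rw [mem_points_iff, mem_unitDisk]; simp

theorem zero_mem_points :
    (0 : ℂ) ∈ (orbifoldDisk N hN).carrier \ (orbifoldDisk N hN).deltaOne := by
  rw [mem_points_iff]; simp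

/-- A decreasing pseudo-distance is continuous at the origin. -/
theorem exists_forall_dist_zero_le (hd : d ∈ (orbifoldDisk N hN).classicalDecreasingPseudoDists)
    {ε : ℝ} (hε : 0 < ε) :
    ∃ ρ > 0, ∀ u : (orbifoldDisk N hN).Points, ‖(u : ℂ)‖ < ρ → d u ⟨0, zero_mem_points⟩ ≤ ε := by
  have hN0 : 0 < N := by exact_mod_cast hN
  have hlim : Tendsto (fun s : ℝ => 2 / (1 - s ^ 2) * s) (𝓝 0) (𝓝 (2 / (1 - 0 ^ 2) * 0)) := by
    refine ContinuousAt.tendsto (f := fun s : ℝ => 2 / (1 - s ^ 2) * s) ?_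
    fun_prop (disch := norm_num)
  rw [mul_zero] at hlim
  obtain ⟨r, hr, hr'⟩ := Metric.eventually_nhds_iff.1 (hlim.eventually_lt_const hε)
  -- An `N`-th root of `u` then has modulus below `r`, and `z ↦ z ^ N` carries the Poincaré estimate
  -- at that root down to `u`.
  refine ⟨r ^ N, pow_pos hr N, fun u hu => ?_⟩
  obtain ⟨z, hz⟩ := IsAlgClosed.exists_pow_nat_eq (u : ℂ) hN0
  have hu1 : (u : ℂ) ∈ unitDisk := mem_points_natCast_iff.1 u.2
  have hzD : z ∈ unitDisk := by
    rw [mem_unitDisk] at hu1 ⊢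
    rw [← hz, norm_pow] at hu1
    by_contra h
    exact absurd hu1 (not_lt.2 (one_le_pow₀ (not_lt.1 h)))
  have hzr : ‖z‖ < r := by
    rw [← hz, norm_pow] at hu
    exact lt_of_pow_lt_pow_left₀ N hr.le hu
  have h0D : (0 : ℂ) ∈ unitDisk := by simp [mem_unitDisk]
  have hb := hd.2 _ (isDiskCovering_pow hN).isClassicalOrbifoldMorphism z 0 hzD h0D
  have e1 : (⟨z ^ N, (isDiskCovering_pow hN).isClassicalOrbifoldMorphism.mem hzD⟩ :
      (orbifoldDisk N hN).Points) = u := Subtype.ext hz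
  have e2 : (⟨0 ^ N, (isDiskCovering_pow hN).isClassicalOrbifoldMorphism.mem h0D⟩ :
      (orbifoldDisk N hN).Points) = ⟨0, zero_mem_points⟩ := Subtype.ext (zero_pow hN0.ne')
  rw [e1, e2] at hb
  have hb' := hb.trans (poincareEDist_zero_le hzD)
  have hz1 := one_sub_norm_sq_pos (mem_unitDisk.1 hzD)
  rw [ENNReal.ofReal_le_ofReal_iff (by positivity)] at hb'
  exact hb'.trans (hr' (by simpa using hzr)).le

/-- The bound for a path that reaches the origin only at its end. -/
theorem ofReal_le_pathLength_of_end_zero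
    (hd : d ∈ (orbifoldDisk N hN).classicalDecreasingPseudoDists) {γ : ℝ → ℂ}
    (hγ : ContDiffOn ℝ 1 γ (Icc 0 1)) (hγD : MapsTo γ (Icc 0 1) unitDisk)
    (hγ0 : ∀ t ∈ Ico (0 : ℝ) 1, γ t ≠ 0) (h1 : γ 1 = 0)
    {x : (orbifoldDisk N hN).Points} (hx : γ 0 = x) :
    ENNReal.ofReal (d x ⟨0, zero_mem_points⟩) ≤ pathLength (orbifoldCoeff N) γ := by
  refine ENNReal.le_of_forall_pos_le_add fun ε hε _ => ?_
  obtain ⟨ρ, hρ, hρ'⟩ := exists_forall_dist_zero_le hd (ε := ε) hε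
  have hcont : Tendsto γ (𝓝[Icc 0 1] 1) (𝓝 0) := by
    have := hγ.continuousOn 1 (by simp)
    rwa [ContinuousWithinAt, h1] at this
  have hsmall : ∀ᶠ s in 𝓝[<] (1 : ℝ), ‖γ s‖ < ρ := by
    have h2 : 𝓝[<] (1 : ℝ) ≤ 𝓝[Icc 0 1] 1 := by
      rw [← nhdsWithin_Ico_eq_nhdsLT zero_lt_one]
      exact nhdsWithin_mono _ Ico_subset_Icc_self
    have h3 := (hcont.norm.mono_left h2)
    rw [norm_zero] at h3
    exact h3.eventually_lt_const hρ
  -- Stopping at a time `s < 1` leaves a path avoiding `0`; what remains costs at most `ε` by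
  -- continuity of `d` at the origin.
  obtain ⟨s, hs, hs01⟩ := (hsmall.and (Ioo_mem_nhdsLT (zero_lt_one' ℝ))).exists
  have hmaps := mapsTo_affine le_rfl hs01.1.le hs01.2.le
  have hsD : γ s ∈ unitDisk := hγD ⟨hs01.1.le, hs01.2.le⟩
  set u : (orbifoldDisk N hN).Points := ⟨γ s, mem_points_natCast_iff.2 hsD⟩ with hu
  have hxu : ENNReal.ofReal (d x u) ≤ pathLength (orbifoldCoeff N) γ := by
    refine (ofReal_le_pathLength_of_ne_zero (isDiskCovering_pow hN) hd
      (contDiffOn_subpath hγ le_rfl hs01.1.le hs01.2.le) (hγD.comp hmaps) (fun t ht => ?_)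
      (by simpa [subpath] using hx) (by simp [subpath, hu])).trans ?_
    · refine hγ0 _ ⟨(hmaps ht).1, ?_⟩
      have := ht.2
      have := hs01.1
      nlinarith [hs01.2]
    · rw [pathLength_subpath hγ le_rfl hs01.1 hs01.2.le]
      exact lintegral_mono_set (Icc_subset_Icc_right hs01.2.le)
  calc ENNReal.ofReal (d x ⟨0, zero_mem_points⟩)
      ≤ ENNReal.ofReal (d x u + d u ⟨0, zero_mem_points⟩) :=
        ENNReal.ofReal_le_ofReal (hd.1.triangle _ _ _)
    _ ≤ ENNReal.ofReal (d x u) + ENNReal.ofReal (d u ⟨0, zero_mem_points⟩) :=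
        ENNReal.ofReal_add_le
    _ ≤ _ := by
        refine add_le_add hxu ?_
        rw [← ENNReal.ofReal_coe_nnreal]
        exact ENNReal.ofReal_le_ofReal (hρ' u hs)

theorem ofReal_le_pathLength_natCast
    (hd : d ∈ (orbifoldDisk N hN).classicalDecreasingPseudoDists) {γ : ℝ → ℂ}
    (hγ : ContDiffOn ℝ 1 γ (Icc 0 1)) (hγD : MapsTo γ (Icc 0 1) unitDisk)
    {x y : (orbifoldDisk N hN).Points} (hx : γ 0 = x) (hy : γ 1 = y) :
    ENNReal.ofReal (d x y) ≤ pathLength (orbifoldCoeff N) γ := by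
  by_cases hγ0 : ∀ t ∈ Icc (0 : ℝ) 1, γ t ≠ 0
  · exact ofReal_le_pathLength_of_ne_zero (isDiskCovering_pow hN) hd hγ hγD hγ0 hx hy
  push Not at hγ0
  set Z : Set ℝ := Icc 0 1 ∩ γ ⁻¹' {0} with hZ
  have hZc : IsCompact Z :=
    isCompact_Icc.of_isClosed_subset
      (hγ.continuousOn.preimage_isClosed_of_isClosed isClosed_Icc isClosed_singleton)
      inter_subset_left
  have hZn : Z.Nonempty := hγ0
  -- Only the parts before the first zero and after the last one matter: the path is at `0` at both
  -- times, so the stretch between can be dropped.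
  obtain ⟨a, ⟨ha01, ha0⟩, ha⟩ := hZc.exists_isLeast hZn
  obtain ⟨b, ⟨hb01, hb0⟩, hb⟩ := hZc.exists_isGreatest hZn
  have ha0' : γ a = 0 := ha0
  have hb0' : γ b = 0 := hb0
  have hab : a ≤ b := ha ⟨hb01, hb0⟩
  set o : (orbifoldDisk N hN).Points := ⟨0, zero_mem_points⟩ with ho
  set F : ℝ → ℝ≥0∞ := fun t =>
    orbifoldCoeff N (γ t) ^ (1 / 2 : ℝ) * ‖derivWithin γ (Icc 0 1) t‖ₑ with hF
  have h1 : ENNReal.ofReal (d x o) ≤ ∫⁻ t in Icc 0 a, F t := by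
    rcases ha01.1.eq_or_lt with h | h
    · have : x = o := Subtype.ext (by rw [← hx, h, ha0'])
      simp [this, hd.1.self]
    · have hmaps := mapsTo_affine le_rfl h.le ha01.2
      rw [← pathLength_subpath hγ le_rfl h ha01.2]
      refine ofReal_le_pathLength_of_end_zero hd (contDiffOn_subpath hγ le_rfl h.le ha01.2)
        (hγD.comp hmaps) (fun t ht h0 => ?_) (by simp [subpath, ha0']) (by simp [subpath, hx])
      have := ha ⟨hmaps (Ico_subset_Icc_self ht), h0⟩
      have := ht.2
      nlinarith
  have h2 : ENNReal.ofReal (d y o) ≤ ∫⁻ t in Icc b 1, F t := by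
    rcases hb01.2.eq_or_lt with h | h
    · have : y = o := Subtype.ext (by rw [← hy, ← h, hb0'])
      simp [this, hd.1.self]
    · have hmaps := mapsTo_affine hb01.1 h.le le_rfl
      have hsub := contDiffOn_subpath hγ hb01.1 h.le le_rfl
      rw [← pathLength_subpath hγ hb01.1 h le_rfl, ← pathLength_reverse hsub]
      refine ofReal_le_pathLength_of_end_zero hd (contDiffOn_reverse hsub)
        ((hγD.comp hmaps).comp mapsTo_one_sub) (fun t ht h0 => ?_) (by simp [subpath, hb0'])
        (by simp [subpath, hy])
      have := hb ⟨hmaps (mapsTo_one_sub (Ico_subset_Icc_self ht)), h0⟩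
      have := ht.2
      nlinarith
  calc ENNReal.ofReal (d x y) ≤ ENNReal.ofReal (d x o + d y o) := by
        refine ENNReal.ofReal_le_ofReal ?_
        rw [hd.1.symm y o]
        exact hd.1.triangle _ _ _
    _ ≤ ENNReal.ofReal (d x o) + ENNReal.ofReal (d y o) := ENNReal.ofReal_add_le
    _ ≤ (∫⁻ t in Icc 0 a, F t) + ∫⁻ t in Icc b 1, F t := add_le_add h1 h2
    _ = ∫⁻ t in Ico 0 a ∪ Icc b 1, F t := by
        -- The half-open interval keeps the two pieces disjoint even when `a = b`.
        rw [← restrict_Ico_eq_restrict_Icc, lintegral_union measurableSet_Icc]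
        refine Set.disjoint_left.2 fun t h3 h4 => ?_
        linarith [h3.2, h4.1]
    _ ≤ pathLength (orbifoldCoeff N) γ := by
        refine lintegral_mono_set (union_subset ?_ ?_)
        · exact Ico_subset_Icc_self.trans (Icc_subset_Icc_right ha01.2)
        · exact Icc_subset_Icc_left hb01.1

end FiniteMultiplicity

/-! ### The induced distance as greatest element of both families. -/

section Main

variable {n : ℕ∞} {hn : 0 < n}

/-- The distance induced by the orbifold metric. -/
def orbifoldEDist (n : ℕ∞) (hn : 0 < n) (x y : (orbifoldDisk n hn).Points) : ℝ≥0∞ :=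
  inducedEDist ((orbifoldDisk n hn).carrier \ (orbifoldDisk n hn).deltaOne) (orbifoldCoeff n) x y

theorem ofReal_le_orbifoldEDist {d : (orbifoldDisk n hn).Points → (orbifoldDisk n hn).Points → ℝ}
    (hd : d ∈ (orbifoldDisk n hn).classicalDecreasingPseudoDists)
    (x y : (orbifoldDisk n hn).Points) : ENNReal.ofReal (d x y) ≤ orbifoldEDist n hn x y := by
  refine le_inducedEDist fun γ hγ hγY hx hy => ?_
  have hγD : MapsTo γ (Icc 0 1) unitDisk := fun t ht => (hγY ht).1
  induction n using ENat.recTopCoe with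
  | top =>
    exact ofReal_le_pathLength_of_ne_zero (isDiskCovering_exp hn) hd hγ hγD
      (fun t ht => (mem_points_iff.1 (hγY ht)).2 rfl) hx hy
  | coe N => exact ofReal_le_pathLength_natCast hd hγ hγD hx hy

theorem orbifoldEDist_map_le {g : ℂ → ℂ} (hg : (orbifoldDisk n hn).IsOrbifoldMorphism g)
    {z w : ℂ} (hz : z ∈ unitDisk) (hw : w ∈ unitDisk) :
    orbifoldEDist n hn ⟨g z, hg.mem hz⟩ ⟨g w, hg.mem hw⟩ ≤ poincareEDist z w :=
  inducedEDist_map_le isOpen_unitDisk hg.differentiableOn (fun _ h => hg.mem h)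
    fun _ h => orbifoldCoeff_mul_deriv_le hg h

theorem IsDiskCovering.exists_eq {p q : ℂ → ℂ} (hp : IsDiskCovering n hn p q)
    (x : (orbifoldDisk n hn).Points) (hx : (x : ℂ) ≠ 0) : ∃ z ∈ unitDisk, p z = x := by
  have hlog : (Complex.log x).re < 0 := by
    rw [Complex.log_re]
    exact Real.log_neg (norm_pos_iff.2 hx) (mem_unitDisk.1 x.2.1)
  exact ⟨q (Complex.log x), hp.mapsTo_lift hlog, by rw [hp.apply_lift _ hlog, Complex.exp_log hx]⟩

theorem exists_isOrbifoldMorphism_surjective (n : ℕ∞) (hn : 0 < n) :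
    ∃ g, (orbifoldDisk n hn).IsOrbifoldMorphism g ∧
      ∀ x : (orbifoldDisk n hn).Points, ∃ z ∈ unitDisk, g z = x := by
  induction n using ENat.recTopCoe with
  | top =>
    refine ⟨_, (isDiskCovering_exp hn).isClassicalOrbifoldMorphism.isOrbifoldMorphism, fun x => ?_⟩
    exact (isDiskCovering_exp hn).exists_eq x ((mem_points_iff.1 x.2).2 rfl)
  | coe N =>
    refine ⟨_, (isDiskCovering_pow hn).isClassicalOrbifoldMorphism.isOrbifoldMorphism, fun x => ?_⟩
    by_cases hx : (x : ℂ) = 0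
    · have hN0 : N ≠ 0 := by rintro rfl; simp at hn
      exact ⟨0, by simp [mem_unitDisk], by simp [hx, hN0]⟩
    · exact (isDiskCovering_pow hn).exists_eq x hx

/-- A single orbifold morphism reaches both points, and it contracts the finite Poincaré distance. A
direct estimate near the singularity of `ω` is thereby avoided. -/
theorem orbifoldEDist_ne_top (x y : (orbifoldDisk n hn).Points) : orbifoldEDist n hn x y ≠ ⊤ := by
  obtain ⟨g, hg, hsurj⟩ := exists_isOrbifoldMorphism_surjective n hn
  obtain ⟨z, hz, hzx⟩ := hsurj x
  obtain ⟨w, hw, hwy⟩ := hsurj y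
  have h := orbifoldEDist_map_le hg hz hw
  rw [show (⟨g z, hg.mem hz⟩ : (orbifoldDisk n hn).Points) = x from Subtype.ext hzx,
    show (⟨g w, hg.mem hw⟩ : (orbifoldDisk n hn).Points) = y from Subtype.ext hwy] at h
  exact ne_top_of_le_ne_top (poincareEDist_ne_top hz hw) h

theorem toReal_orbifoldEDist_mem :
    (fun x y => (orbifoldEDist n hn x y).toReal) ∈ (orbifoldDisk n hn).decreasingPseudoDists := by
  refine ⟨⟨fun _ _ => ENNReal.toReal_nonneg, fun x => ?_, fun x y => ?_, fun x y z => ?_⟩, ?_⟩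
  · simp [orbifoldEDist, inducedEDist_self x.2]
  · simp only [orbifoldEDist]
    rw [inducedEDist_comm]
  · rw [← ENNReal.toReal_add (orbifoldEDist_ne_top _ _) (orbifoldEDist_ne_top _ _)]
    exact ENNReal.toReal_mono (ENNReal.add_ne_top.2
      ⟨orbifoldEDist_ne_top _ _, orbifoldEDist_ne_top _ _⟩) inducedEDist_triangle
  · intro g hg z w hz hw
    rw [ENNReal.ofReal_toReal (orbifoldEDist_ne_top _ _)]
    exact orbifoldEDist_map_le hg hz hw

theorem decreasingPseudoDists_subset (X : PlaneOrbifold) :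
    X.decreasingPseudoDists ⊆ X.classicalDecreasingPseudoDists := fun _ hd =>
  ⟨hd.1, fun g hg z w hz hw => hd.2 g hg.isOrbifoldMorphism z w hz hw⟩

/-- Membership comes from the family with more morphisms to test, the upper bound from the one with
fewer; the nonclassical case then follows by inclusion. -/
theorem isGreatest_classical :
    IsGreatest (orbifoldDisk n hn).classicalDecreasingPseudoDists
      fun x y => (orbifoldEDist n hn x y).toReal :=
  ⟨decreasingPseudoDists_subset _ toReal_orbifoldEDist_mem, fun _ hd x y =>
    (ENNReal.ofReal_le_iff_le_toReal (orbifoldEDist_ne_top x y)).1 (ofReal_le_orbifoldEDist hd x y)⟩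

theorem isGreatest_decreasing :
    IsGreatest (orbifoldDisk n hn).decreasingPseudoDists
      fun x y => (orbifoldEDist n hn x y).toReal :=
  ⟨toReal_orbifoldEDist_mem, fun _ hd => isGreatest_classical.2 (decreasingPseudoDists_subset _ hd)⟩

/-- The pointwise supremum of a set of functions with a greatest element is that element. -/
theorem sSup_apply_eq_of_isGreatest {α : Type} {S : Set (α → α → ℝ)} {D : α → α → ℝ}
    (h : IsGreatest S D) (x y : α) : sSup {r | ∃ d ∈ S, d x y = r} = D x y :=
  IsGreatest.csSup_eq ⟨⟨D, h.1, rfl⟩, by rintro _ ⟨d, hd, rfl⟩; exact h.2 hd x y⟩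

theorem kobayashiDist_eq : (orbifoldDisk n hn).kobayashiDist =
    fun x y => (orbifoldEDist n hn x y).toReal :=
  funext fun x => funext fun y => sSup_apply_eq_of_isGreatest isGreatest_decreasing x y

theorem classicalKobayashiDist_eq : (orbifoldDisk n hn).classicalKobayashiDist =
    fun x y => (orbifoldEDist n hn x y).toReal :=
  funext fun x => funext fun y => sSup_apply_eq_of_isGreatest isGreatest_classical x y

end Main

end OrbifoldKobayashi

end
theorem mainTheorem5 (n : ℕ∞) (hn : 0 < n) :
    IsGreatest (OrbifoldKobayashi.orbifoldDisk n hn).decreasingPseudoDists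
      (OrbifoldKobayashi.orbifoldDisk n hn).kobayashiDist ∧
    IsGreatest (OrbifoldKobayashi.orbifoldDisk n hn).classicalDecreasingPseudoDists
      (OrbifoldKobayashi.orbifoldDisk n hn).classicalKobayashiDist ∧
    (OrbifoldKobayashi.orbifoldDisk n hn).kobayashiDist =
      (OrbifoldKobayashi.orbifoldDisk n hn).classicalKobayashiDist ∧
    ∀ x y : (OrbifoldKobayashi.orbifoldDisk n hn).Points,
      ENNReal.ofReal ((OrbifoldKobayashi.orbifoldDisk n hn).kobayashiDist x y) =
        OrbifoldKobayashi.inducedEDist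
          ((OrbifoldKobayashi.orbifoldDisk n hn).carrier \
            (OrbifoldKobayashi.orbifoldDisk n hn).deltaOne)
          (OrbifoldKobayashi.orbifoldCoeff n) x y := by
  rw [OrbifoldKobayashi.kobayashiDist_eq, OrbifoldKobayashi.classicalKobayashiDist_eq]
  exact ⟨OrbifoldKobayashi.isGreatest_decreasing, OrbifoldKobayashi.isGreatest_classical, rfl,
    fun x y => ENNReal.ofReal_toReal (OrbifoldKobayashi.orbifoldEDist_ne_top x y)⟩
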